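/- Here $C^\infty$ on a convex set means smooth up to the boundary. Consider the following categories, whose underlying objects are sets (Chen, Souriau, Frölicher) or topological spaces (Smith, Sikorski). * A \emph{Chen space} (resp. \emph{Souriau space}) is a set $X$ with a family of maps into $X$, called plots, whose domains are convex (resp. open) subsets of Euclidean spaces, such that constant maps are plots, precomposing a plot with a $C^\infty$ map of such domains gives a plot, and a map which is everywhere locally a plot is a plot. Morphisms are the maps taking plots to plots. * A \emph{Frölicher space} is a set $X$ with curves $\mathcal C\subseteq \mathrm{Map}(\mathbb R,X)$ and functionals $\mathcal F\subseteq \mathrm{Map}(X,\mathbb R)$ such that $c\in\mathcal C$ iff $fc\in C^\infty$ for all $f\in\mathcal F$, and $f\in\mathcal F$ iff $fc\in C^\infty$ for all $c\in\mathcal C$. Morphisms are the maps taking curves to curves. The Frölicher structure \emph{determined} by a set $\mathcal G$ of functions $X\to\mathbb R$ has as curves all $c\colon\mathbb R\to X$ with $gc\in C^\infty(\mathbb R,\mathbb R)$ for all $g\in\mathcal G$, and as functionals all functions that are $C^\infty$ along these curves. * For a set $\mathcal F$ of continuous real functions on a topological space $X$, let $\overline{\mathcal F}$ be the set of continuous $g\colon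 X\to\mathbb R$ such that $g\phi\in C^\infty(U,\mathbb R)$ for every open $U\subseteq\mathbb R^n$ ($n$ arbitrary) and every continuous $\phi\colon U\to X$ with $f\phi\in C^\infty(U,\mathbb R)$ for all $f\in\mathcal F$. A \emph{Smith space} is a topological space $X$ with a set $\mathcal F$ of continuous real functions such that $\overline{\mathcal F}=\mathcal F$. * A \emph{Sikorski space} is a topological space $X$ with a subalgebra $\mathcal F$ of the algebra of continuous real functions that contains every function which is locally equal to members of $\mathcal F$, and every $g(f_1,\dots,f_k)$ with $f_i\in\mathcal F$, $g\in C^\infty(\mathbb R^k,\mathbb R)$. Morphisms of Smith and of Sikorski spaces are the continuous maps that pull functionals back to functionals. Consider the following functors, all of which are the identity on underlying sets and maps. * $\mathrm{ChSo}$ (Chen to Souriau): the plots are the maps $U\to X$, $U$ open, that are Chen morphisms for the standard Chen structure on $U$. * $\mathrm{SoCh}^{+}$ (Souriau to Chen): the plots are the maps $C\to X$, $C$ convex, that are Souriau morphisms for the standard Souriau structure on $C$. $\mathrm{SoCh}^{-}$ (Souriau to Chen): the plots are the maps $C\to X$, $C$ convex, that locally factor, through $C^\infty$ maps, through plots of $X$.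 * $\mathrm{SoFr}$ (Souriau to Frölicher): the Frölicher structure determined by the Souriau morphisms $X\to\mathbb R$. $\mathrm{FrSo}$ (Frölicher to Souriau): the plots are the maps $\phi\colon U\to X$, $U$ open, with $f\phi\in C^\infty(U,\mathbb R)$ for every functional $f$. * $\mathrm{SmFr}$ (Smith to Frölicher): the Frölicher structure determined by the functionals. $\mathrm{FrSm}$ (Frölicher to Smith): keep the functionals, and take either the finest topology making all curves continuous or the coarsest topology making all functionals continuous; this gives two functors, and the claims below hold for both. * $\mathrm{SmSi}$ (Smith to Sikorski): the inclusion. $\mathrm{SiSm}$ (Sikorski to Smith): $(X,\mathcal F)\mapsto(X,\overline{\mathcal F})$. There are adjunctions $\mathrm{SoFr}\dashv\mathrm{FrSo}$, $\ \mathrm{SoCh}^{-}\dashv\mathrm{ChSo}\dashv\mathrm{SoCh}^{+}$, $\ \mathrm{SmSi}\dashv\mathrm{SiSm}$, and none of these functors has any further left or right adjoint. Precisely: 1. $\mathrm{SmFr}$ and (both versions of) $\mathrm{FrSm}$ preserve neither all small limits nor all small colimits, and none of them is a left adjoint or a right adjoint. 2. $\mathrm{SiSm}$ does not preserve all small colimits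 and is not a left adjoint; $\mathrm{SmSi}$ does not preserve all small limits and is not a right adjoint. 3. $\mathrm{SoFr}$ does not preserve all small limits and is not a right adjoint; $\mathrm{FrSo}$ does not preserve all small colimits and is not a left adjoint. 4. $\mathrm{SoCh}^{+}$, the right adjoint of $\mathrm{ChSo}$, does not preserve all small colimits and is not a left adjoint; $\mathrm{SoCh}^{-}$, the left adjoint of $\mathrm{ChSo}$, does not preserve all small limits and is not a right adjoint. -/

import Mathlib

open CategoryTheory CategoryTheory.Limits Topology
open scoped ContDiff

/-- Euclidean space `ℝⁿ`. -/
abbrev Euc (n : ℕ) : Type := EuclideanSpace ℝ (Fin n)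

/-- A map defined on a subset `A` of a Euclidean space (in practice `A` is open or convex) is smooth.
On a convex set this is smoothness up to the boundary: the map is smooth in the relative interior
and all derivatives extend continuously to `A`. -/
def SmoothMap {n : ℕ} {A : Set (Euc n)} {V : Type} [NormedAddCommGroup V] [NormedSpace ℝ V]
    (θ : A → V) : Prop :=
  ∃ g : Euc n → V, ContDiffOn ℝ ∞ g A ∧ ∀ x : A, g x = θ x

theorem SmoothMap.const {n : ℕ} {A : Set (Euc n)} {V : Type} [NormedAddCommGroup V]
    [NormedSpace ℝ V] (v : V) : SmoothMap (fun _ : A => v) :=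
  ⟨fun _ => v, contDiffOn_const, fun _ => rfl⟩

theorem SmoothMap.val {n : ℕ} {A : Set (Euc n)} : SmoothMap (fun x : A => (x : Euc n)) :=
  ⟨id, contDiffOn_id, fun _ => rfl⟩

theorem SmoothMap.comp {m n : ℕ} {A : Set (Euc n)} {B : Set (Euc m)} {V : Type}
    [NormedAddCommGroup V] [NormedSpace ℝ V] {φ : A → V} (hφ : SmoothMap φ) {θ : B → A}
    (hθ : SmoothMap (fun x => (θ x : Euc n))) : SmoothMap (φ ∘ θ) := by
  obtain ⟨g, hg, hgφ⟩ := hφ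
  obtain ⟨k, hk, hkθ⟩ := hθ
  refine ⟨g ∘ k, hg.comp hk ?_, ?_⟩
  · intro x hx
    have := hkθ ⟨x, hx⟩
    simp only at this
    change k x ∈ A
    rw [this]
    exact (θ ⟨x, hx⟩).2
  · intro x
    simp only [Function.comp_apply, hkθ x, hgφ]

theorem SmoothMap.inclusion {n : ℕ} {A B : Set (Euc n)} (h : B ⊆ A) :
    SmoothMap (fun x : B => (Set.inclusion h x : Euc n)) :=
  ⟨id, contDiffOn_id, fun _ => rfl⟩

theorem SmoothMap.continuous {n : ℕ} {A : Set (Euc n)} {V : Type} [NormedAddCommGroup V]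
    [NormedSpace ℝ V] {φ : A → V} (h : SmoothMap φ) : Continuous φ := by
  obtain ⟨g, hg, hgφ⟩ := h
  have h1 : φ = A.domRestrict g := by
    funext x
    exact (hgφ x).symm
  rw [h1]
  exact hg.continuousOn.domRestrict

theorem SmoothMap.of_local {n : ℕ} {A : Set (Euc n)} {V : Type} [NormedAddCommGroup V]
    [NormedSpace ℝ V] {φ : A → V}
    (h : ∀ x : A, ∃ (B : Set (Euc n)) (hB : B ⊆ A), B ∈ 𝓝[A] (x : Euc n) ∧
      SmoothMap (φ ∘ Set.inclusion hB)) : SmoothMap φ := by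
  classical
  refine ⟨fun x => if hx : x ∈ A then φ ⟨x, hx⟩ else 0, ?_, fun x => by simp⟩
  intro x hx
  obtain ⟨B, hB, hBx, g, hg, hgφ⟩ := h ⟨x, hx⟩
  have hxB : x ∈ B := mem_of_mem_nhdsWithin hx hBx
  have h1 : ContDiffWithinAt ℝ ∞ g A x := (hg x hxB).mono_of_mem_nhdsWithin hBx
  have h2 : ∀ y (hy : y ∈ B), (if hx : y ∈ A then φ ⟨y, hx⟩ else 0) = g y := by
    intro y hy
    rw [dif_pos (hB hy)]
    exact (hgφ ⟨y, hy⟩).symm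
  refine h1.congr_of_eventuallyEq ?_ (h2 x hxB)
  filter_upwards [hBx] with y hy using h2 y hy

/-! ### Spaces defined by plots: Chen spaces and Souriau spaces -/

/-- A class of subsets of Euclidean spaces which serve as domains of plots. -/
structure TestDomains where
  dom : ∀ n : ℕ, Set (Euc n) → Prop
  univ_dom : ∀ n, dom n Set.univ
  inter_ball : ∀ (n : ℕ) (A : Set (Euc n)) (x : Euc n) (r : ℝ),
    dom n A → dom n (A ∩ Metric.ball x r)

/-- The open subsets of Euclidean spaces. -/
def openDomains : TestDomains where
  dom _ A := IsOpen A
  univ_dom _ := isOpen_univ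
  inter_ball _ _ _ _ h := h.inter Metric.isOpen_ball

/-- The convex subsets of Euclidean spaces. -/
def convexDomains : TestDomains where
  dom _ A := Convex ℝ A
  univ_dom _ := convex_univ
  inter_ball _ _ x r h := h.inter (convex_ball x r)

theorem TestDomains.exists_nhds (T : TestDomains) {n : ℕ} {A S : Set (Euc n)} (hA : T.dom n A)
    {x : Euc n} (hS : S ∈ 𝓝[A] x) :
    ∃ B : Set (Euc n), B ⊆ A ∧ T.dom n B ∧ B ∈ 𝓝[A] x ∧ B ⊆ S := by
  obtain ⟨r, hr, h⟩ := Metric.mem_nhdsWithin_iff.1 hS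
  refine ⟨A ∩ Metric.ball x r, Set.inter_subset_left, T.inter_ball n A x r hA, ?_, ?_⟩
  · exact Filter.inter_mem self_mem_nhdsWithin
      (mem_nhdsWithin_of_mem_nhds (Metric.ball_mem_nhds x hr))
  · rintro y ⟨hy, hy'⟩
    exact h ⟨hy', hy⟩

theorem TestDomains.exists_preimage (T : TestDomains) {m n : ℕ} {A : Set (Euc n)}
    {C : Set (Euc m)} (hC : T.dom m C) {θ : C → A} (hθ : SmoothMap (fun x => (θ x : Euc n)))
    (x : C) {B : Set (Euc n)} (hB : B ∈ 𝓝[A] (θ x : Euc n)) :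
    ∃ (D : Set (Euc m)) (hD : D ⊆ C), T.dom m D ∧ D ∈ 𝓝[C] (x : Euc m) ∧
      ∀ y : D, (θ (Set.inclusion hD y) : Euc n) ∈ B := by
  have hcont : Continuous θ := Continuous.subtype_mk hθ.continuous (fun x => (θ x).2)
  have h1 : (Subtype.val ⁻¹' B : Set A) ∈ 𝓝 (θ x) := by
    rw [nhds_subtype_eq_comap_nhdsWithin]
    exact Filter.preimage_mem_comap hB
  have h2 := hcont.continuousAt.preimage_mem_nhds h1
  rw [nhds_subtype_eq_comap_nhdsWithin] at h2
  obtain ⟨S, hS, hSsub⟩ := h2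
  obtain ⟨D, hDC, hD, hDx, hDS⟩ := T.exists_nhds hC hS
  exact ⟨D, hDC, hD, hDx, fun y => hSsub (hDS y.2)⟩

/-- A family of plots on the set `X`: it contains the constant maps, is closed under precomposition
with smooth maps between test domains, and contains every map (on a test domain) which is everywhere
locally a plot. -/
structure PlotStructure (T : TestDomains) (X : Type) where
  IsPlot : ∀ {n : ℕ} {A : Set (Euc n)}, (A → X) → Prop
  dom_of_isPlot : ∀ {n : ℕ} {A : Set (Euc n)} {φ : A → X}, IsPlot φ → T.dom n A
  isPlot_const : ∀ {n : ℕ} {A : Set (Euc n)}, T.dom n A → ∀ x : X, IsPlot (fun _ : A => x)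
  isPlot_comp : ∀ {m n : ℕ} {A : Set (Euc n)} {B : Set (Euc m)} {φ : A → X} {θ : B → A},
    IsPlot φ → T.dom m B → SmoothMap (fun x => (θ x : Euc n)) → IsPlot (φ ∘ θ)
  isPlot_of_local : ∀ {n : ℕ} {A : Set (Euc n)} {φ : A → X}, T.dom n A →
    (∀ x : A, ∃ (B : Set (Euc n)) (hB : B ⊆ A), T.dom n B ∧ B ∈ 𝓝[A] (x : Euc n) ∧
      IsPlot (φ ∘ Set.inclusion hB)) → IsPlot φ

/-- A set with a family of plots. -/
structure PlotSpace (T : TestDomains) where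
  carrier : Type
  str : PlotStructure T carrier

/-- A morphism is a map which takes plots to plots. -/
@[ext]
structure PlotSpace.Hom {T : TestDomains} (X Y : PlotSpace T) where
  toFun : X.carrier → Y.carrier
  isPlot : ∀ {n : ℕ} {A : Set (Euc n)} {φ : A → X.carrier},
    X.str.IsPlot φ → Y.str.IsPlot (toFun ∘ φ)

instance PlotSpace.category (T : TestDomains) : Category (PlotSpace T) where
  Hom X Y := PlotSpace.Hom X Y
  id X := ⟨id, fun h => h⟩
  comp f g := ⟨g.toFun ∘ f.toFun, fun h => g.isPlot (f.isPlot h)⟩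

/-- Chen spaces: the plots are defined on convex subsets of Euclidean spaces. -/
abbrev ChenSpace : Type 1 := PlotSpace convexDomains

/-- Souriau spaces (diffeological spaces): the plots are defined on open subsets of
Euclidean spaces. -/
abbrev SouriauSpace : Type 1 := PlotSpace openDomains

/-- The standard structure on a subset of a Euclidean space: the plots are the smooth maps. -/
def PlotSpace.std (T : TestDomains) {m : ℕ} (A : Set (Euc m)) : PlotSpace T where
  carrier := A
  str :=
    { IsPlot := fun {n} {C} θ => T.dom n C ∧ SmoothMap (fun x => (θ x : Euc m))
      dom_of_isPlot := fun h => h.1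
      isPlot_const := fun h x => ⟨h, SmoothMap.const (x : Euc m)⟩
      isPlot_comp := fun h hB hθ => ⟨hB, h.2.comp hθ⟩
      isPlot_of_local := by
        intro n C φ hC h
        refine ⟨hC, SmoothMap.of_local fun x => ?_⟩
        obtain ⟨B, hB, -, hBx, -, hs⟩ := h x
        exact ⟨B, hB, hBx, hs⟩ }

/-- The maximal change of test domains. The plots `φ : A → X` of the new structure are the maps
which underlie a morphism to `X` from `A` with its standard structure of the old kind. -/
def PlotSpace.maxChange (T T' : TestDomains) : PlotSpace T ⥤ PlotSpace T' where
  obj X :=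
    { carrier := X.carrier
      str :=
        { IsPlot := fun {n} {A} φ =>
            T'.dom n A ∧ ∃ h : PlotSpace.std T A ⟶ X, h.toFun = φ
          dom_of_isPlot := fun h => h.1
          isPlot_const := fun h x =>
            ⟨h, ⟨fun _ => x, fun hp => X.str.isPlot_const (X := X.carrier) hp.1 x⟩, rfl⟩
          isPlot_comp := by
            rintro m n A B φ θ ⟨-, h, rfl⟩ hB hθ
            exact ⟨hB, ⟨h.toFun ∘ θ, fun {k C ψ} hp =>
              h.isPlot (φ := θ ∘ ψ) ⟨hp.1, SmoothMap.comp hθ hp.2⟩⟩, rfl⟩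
          isPlot_of_local := by
            intro n A φ hA hloc
            refine ⟨hA, ⟨φ, ?_⟩, rfl⟩
            rintro k C θ ⟨hC, hθ⟩
            refine X.str.isPlot_of_local hC fun x => ?_
            obtain ⟨B, hBA, -, hBx, -, h, hh⟩ := hloc (θ x)
            obtain ⟨D, hDC, hD, hDx, hDB⟩ := T.exists_preimage hC hθ x hBx
            refine ⟨D, hDC, hD, hDx, ?_⟩
            have hs : SmoothMap (fun y : D => ((show A from θ (Set.inclusion hDC y)) : Euc n)) :=
              SmoothMap.comp hθ (SmoothMap.inclusion hDC)
            have key := h.isPlot (A := D)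
              (φ := fun y => (⟨((show A from θ (Set.inclusion hDC y)) : Euc n), hDB y⟩ : B))
              ⟨hD, hs⟩
            rw [hh] at key
            exact key } }
  map f := ⟨f.toFun, by
    rintro n A φ ⟨hA, h, rfl⟩
    exact ⟨hA, h ≫ f, rfl⟩⟩

/-- The minimal change of test domains. The plots of the new structure are the maps which
locally factor, through smooth maps, through the plots of the old structure. -/
def PlotSpace.minChange (T T' : TestDomains) : PlotSpace T ⥤ PlotSpace T' where
  obj X :=
    { carrier := X.carrier
      str :=
        { IsPlot := fun {n} {A} φ =>
            T'.dom n A ∧ ∀ x : A, ∃ (B : Set (Euc n)) (hB : B ⊆ A),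
              T'.dom n B ∧ B ∈ 𝓝[A] (x : Euc n) ∧
              ∃ (m : ℕ) (U : Set (Euc m)) (p : U → X.carrier) (θ : B → U),
                X.str.IsPlot p ∧ SmoothMap (fun y => (θ y : Euc m)) ∧
                φ ∘ Set.inclusion hB = p ∘ θ
          dom_of_isPlot := fun h => h.1
          isPlot_const := fun {n} {A} h x =>
            ⟨h, fun _ => ⟨A, subset_rfl, h, self_mem_nhdsWithin, n, Set.univ, fun _ => x,
              fun y => ⟨y, trivial⟩, X.str.isPlot_const (T.univ_dom n) x, SmoothMap.val, rfl⟩⟩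
          isPlot_comp := by
            rintro m n A C φ ψ ⟨-, h⟩ hC hψ
            refine ⟨hC, fun x => ?_⟩
            obtain ⟨B, hBA, -, hBx, k, U, p, θ, hp, hθ, hfac⟩ := h (ψ x)
            obtain ⟨D, hDC, hD, hDx, hDB⟩ := T'.exists_preimage hC hψ x hBx
            refine ⟨D, hDC, hD, hDx, k, U, p,
              fun y => θ ⟨(ψ (Set.inclusion hDC y) : Euc n), hDB y⟩, hp, ?_, ?_⟩
            · exact SmoothMap.comp (φ := fun y => (θ y : Euc k)) hθ
                (θ := fun y : D => (⟨(ψ (Set.inclusion hDC y) : Euc n), hDB y⟩ : B))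
                (SmoothMap.comp (φ := fun x => (ψ x : Euc n)) hψ (SmoothMap.inclusion hDC))
            · funext y
              exact congrFun hfac ⟨(ψ (Set.inclusion hDC y) : Euc n), hDB y⟩
          isPlot_of_local := by
            intro n A φ hA hloc
            refine ⟨hA, fun x => ?_⟩
            obtain ⟨B, hBA, hB, hBx, -, h⟩ := hloc x
            have hxB : (x : Euc n) ∈ B := mem_of_mem_nhdsWithin x.2 hBx
            obtain ⟨D, hDB, hD, hDx, k, U, p, θ, hp, hθ, hfac⟩ := h ⟨x, hxB⟩
            refine ⟨D, hDB.trans hBA, hD, ?_, k, U, p, θ, hp, hθ, hfac⟩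
            exact nhdsWithin_le_of_mem hBx hDx } }
  map f := ⟨f.toFun, by
    rintro n A φ ⟨hA, h⟩
    refine ⟨hA, fun x => ?_⟩
    obtain ⟨B, hBA, hB, hBx, k, U, p, θ, hp, hθ, hfac⟩ := h x
    exact ⟨B, hBA, hB, hBx, k, U, f.toFun ∘ p, θ, f.isPlot hp, hθ,
      congrArg (fun q => f.toFun ∘ q) hfac⟩⟩

/-! ### Frölicher spaces -/

/-- A Frölicher space: a set with curves and functionals which determine each other. -/
structure FrolicherSpace where
  carrier : Type
  curves : Set (ℝ → carrier)
  functionals : Set (carrier → ℝ)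
  mem_curves_iff : ∀ c : ℝ → carrier,
    c ∈ curves ↔ ∀ f ∈ functionals, ContDiff ℝ ∞ (f ∘ c)
  mem_functionals_iff : ∀ f : carrier → ℝ,
    f ∈ functionals ↔ ∀ c ∈ curves, ContDiff ℝ ∞ (f ∘ c)

/-- A morphism of Frölicher spaces takes curves to curves. -/
@[ext]
structure FrolicherSpace.Hom (X Y : FrolicherSpace) where
  toFun : X.carrier → Y.carrier
  mem_curves : ∀ c ∈ X.curves, toFun ∘ c ∈ Y.curves

instance FrolicherSpace.category : Category FrolicherSpace where
  Hom X Y := FrolicherSpace.Hom X Y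
  id X := ⟨id, fun _ h => h⟩
  comp f g := ⟨g.toFun ∘ f.toFun, fun c h => g.mem_curves _ (f.mem_curves c h)⟩

theorem FrolicherSpace.Hom.mem_functionals {X Y : FrolicherSpace} (h : FrolicherSpace.Hom X Y)
    (f : Y.carrier → ℝ) (hf : f ∈ Y.functionals) : f ∘ h.toFun ∈ X.functionals :=
  (X.mem_functionals_iff _).2 fun c hc => (Y.mem_curves_iff _).1 (h.mem_curves c hc) f hf

/-- The Frölicher space determined by a set `F` of functions on `X`: its curves are the maps
`c : ℝ → X` for which `f ∘ c` is smooth for all `f ∈ F`, and its functionals are the functions which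
are smooth along all these curves. -/
def FrolicherSpace.ofFunctions (X : Type) (F : Set (X → ℝ)) : FrolicherSpace where
  carrier := X
  curves := {c | ∀ f ∈ F, ContDiff ℝ ∞ (f ∘ c)}
  functionals := {f | ∀ c : ℝ → X, (∀ g ∈ F, ContDiff ℝ ∞ (g ∘ c)) → ContDiff ℝ ∞ (f ∘ c)}
  mem_curves_iff c := ⟨fun h _ hf => hf c h, fun h f hf => h f fun _ hc => hc f hf⟩
  mem_functionals_iff _ := Iff.rfl

/-! ### Smith spaces and Sikorski spaces -/

/-- For a set `F` of functions on a topological space `X` and a subset `U` of `ℝⁿ`, the continuous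
maps `φ : U → X` such that `f ∘ φ` is smooth for all `f ∈ F`. -/
def ContSmooth {X : Type} [TopologicalSpace X] (F : Set (X → ℝ)) {n : ℕ} {U : Set (Euc n)}
    (φ : U → X) : Prop :=
  Continuous φ ∧ ∀ f ∈ F, SmoothMap (f ∘ φ)

/-- The set of continuous functions `g` on `X` such that `g ∘ φ` is smooth for every open
`U ⊆ ℝⁿ`, `n` arbitrary, and every continuous `φ : U → X` for which all `f ∘ φ`, `f ∈ F`,
are smooth. -/
def smithClosure {X : Type} [TopologicalSpace X] (F : Set (X → ℝ)) : Set (X → ℝ) :=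
  {g | Continuous g ∧ ∀ (n : ℕ) (U : Set (Euc n)), IsOpen U →
    ∀ φ : U → X, ContSmooth F φ → SmoothMap (g ∘ φ)}

theorem subset_smithClosure {X : Type} [TopologicalSpace X] {F : Set (X → ℝ)}
    (hF : ∀ f ∈ F, Continuous f) : F ⊆ smithClosure F :=
  fun f hf => ⟨hF f hf, fun _ _ _ _ hφ => hφ.2 f hf⟩

/-- A Smith space. -/
structure SmithSpace where
  carrier : Type
  [top : TopologicalSpace carrier]
  functionals : Set (carrier → ℝ)
  continuous_of_mem : ∀ f ∈ functionals, Continuous f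
  closure_subset : smithClosure functionals ⊆ functionals

attribute [instance] SmithSpace.top

/-- A morphism of Smith spaces is a continuous map which pulls functionals back to functionals. -/
@[ext]
structure SmithSpace.Hom (X Y : SmithSpace) where
  toFun : X.carrier → Y.carrier
  cont : Continuous toFun
  mem_functionals : ∀ f ∈ Y.functionals, f ∘ toFun ∈ X.functionals

instance SmithSpace.category : Category SmithSpace where
  Hom X Y := SmithSpace.Hom X Y
  id X := ⟨id, continuous_id, fun _ h => h⟩
  comp f g := ⟨g.toFun ∘ f.toFun, g.cont.comp f.cont,
    fun u hu => f.mem_functionals _ (g.mem_functionals u hu)⟩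

/-- A Sikorski space. -/
structure SikorskiSpace where
  carrier : Type
  [top : TopologicalSpace carrier]
  functionals : Subalgebra ℝ (carrier → ℝ)
  continuous_of_mem : ∀ f ∈ functionals, Continuous f
  mem_of_local : ∀ f : carrier → ℝ,
    (∀ x, ∃ V ∈ 𝓝 x, ∃ g ∈ functionals, ∀ y ∈ V, f y = g y) → f ∈ functionals
  comp_mem : ∀ (k : ℕ) (f : Fin k → carrier → ℝ), (∀ i, f i ∈ functionals) →
    ∀ g : Euc k → ℝ, ContDiff ℝ ∞ g →
      (fun x => g (WithLp.toLp 2 fun i => f i x)) ∈ functionals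

attribute [instance] SikorskiSpace.top

/-- A morphism of Sikorski spaces is a continuous map which pulls functionals back to
functionals. -/
@[ext]
structure SikorskiSpace.Hom (X Y : SikorskiSpace) where
  toFun : X.carrier → Y.carrier
  cont : Continuous toFun
  mem_functionals : ∀ f ∈ Y.functionals, f ∘ toFun ∈ X.functionals

instance SikorskiSpace.category : Category SikorskiSpace where
  Hom X Y := SikorskiSpace.Hom X Y
  id X := ⟨id, continuous_id, fun _ h => h⟩
  comp f g := ⟨g.toFun ∘ f.toFun, g.cont.comp f.cont,
    fun u hu => f.mem_functionals _ (g.mem_functionals u hu)⟩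

/-! ### The functors -/

/-- Chen to Souriau: the plots are the maps `U → X` which underlie Chen morphisms, where
`U` is open with its standard Chen structure. -/
def ChSo : ChenSpace ⥤ SouriauSpace := PlotSpace.maxChange convexDomains openDomains

/-- Souriau to Chen, the larger structure: the plots are the maps `C → X` which underlie Souriau
morphisms, where `C` is convex with its standard diffeology. -/
def SoChMax : SouriauSpace ⥤ ChenSpace := PlotSpace.maxChange openDomains convexDomains

/-- Souriau to Chen, the smaller structure: the plots are the maps on convex sets which locally
factor through plots of the diffeology. -/
def SoChMin : SouriauSpace ⥤ ChenSpace := PlotSpace.minChange openDomains convexDomains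

/-- The functionals of a Souriau space: its morphisms to `ℝ` with the standard diffeology. -/
def PlotSpace.functionals {T : TestDomains} (X : PlotSpace T) : Set (X.carrier → ℝ) :=
  {f | ∀ {n : ℕ} {U : Set (Euc n)} {φ : U → X.carrier}, X.str.IsPlot φ → SmoothMap (f ∘ φ)}

/-- Souriau to Frölicher: the curves are those along which all Souriau functionals are smooth;
they determine the functionals. (By Boman's theorem on functions which are smooth
along smooth curves, these are again exactly the Souriau functionals.) -/
def SoFr : SouriauSpace ⥤ FrolicherSpace where
  obj X := FrolicherSpace.ofFunctions X.carrier X.functionals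
  map h := ⟨h.toFun, fun _ hc f hf => hc (f ∘ h.toFun) fun hp => hf (h.isPlot hp)⟩

/-- Frölicher to Souriau: the plots are the morphisms from open sets `U` with their usual smooth
structure, that is, the maps which pull functionals back to smooth functions on `U`. -/
def FrSo : FrolicherSpace ⥤ SouriauSpace where
  obj X :=
    { carrier := X.carrier
      str :=
        { IsPlot := fun {n} {U} φ => IsOpen U ∧ ∀ f ∈ X.functionals, SmoothMap (f ∘ φ)
          dom_of_isPlot := fun h => h.1
          isPlot_const := fun h x => ⟨h, fun f _ => SmoothMap.const (f x)⟩
          isPlot_comp := fun h hB hθ => ⟨hB, fun f hf => (h.2 f hf).comp hθ⟩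
          isPlot_of_local := by
            intro n A φ hA h
            refine ⟨hA, fun f hf => SmoothMap.of_local fun x => ?_⟩
            obtain ⟨B, hB, -, hBx, -, hs⟩ := h x
            exact ⟨B, hB, hBx, hs f hf⟩ } }
  map h := ⟨h.toFun, fun hp => ⟨hp.1, fun f hf =>
    hp.2 (f ∘ h.toFun) (FrolicherSpace.Hom.mem_functionals h f hf)⟩⟩

/-- Smith to Frölicher: the curves are the (not necessarily continuous) maps along which all Smith
functionals are smooth; they determine the functionals. -/
def SmFr : SmithSpace ⥤ FrolicherSpace where
  obj X := FrolicherSpace.ofFunctions X.carrier X.functionals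
  map h := ⟨h.toFun, fun _ hc f hf => hc (f ∘ h.toFun) (h.mem_functionals f hf)⟩

/-- The curvaceous topology: the finest topology for which all curves are continuous. -/
@[reducible] def FrolicherSpace.curvTop (X : FrolicherSpace) : TopologicalSpace X.carrier :=
  ⨆ c ∈ X.curves, TopologicalSpace.coinduced c inferInstance

/-- The functional topology: the coarsest topology for which all functionals are continuous. -/
@[reducible] def FrolicherSpace.funcTop (X : FrolicherSpace) : TopologicalSpace X.carrier :=
  ⨅ f ∈ X.functionals, TopologicalSpace.induced f inferInstance

theorem FrolicherSpace.continuous_curv (X : FrolicherSpace) {c : ℝ → X.carrier}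
    (hc : c ∈ X.curves) : @Continuous _ _ _ X.curvTop c :=
  continuous_iff_coinduced_le.2
    (le_iSup₂ (f := fun (c : ℝ → X.carrier) (_ : c ∈ X.curves) =>
      TopologicalSpace.coinduced c inferInstance) c hc)

theorem FrolicherSpace.continuous_func (X : FrolicherSpace) {f : X.carrier → ℝ}
    (hf : f ∈ X.functionals) : @Continuous _ _ X.funcTop _ f :=
  continuous_iff_le_induced.2
    (iInf₂_le (f := fun (f : X.carrier → ℝ) (_ : f ∈ X.functionals) =>
      TopologicalSpace.induced f inferInstance) f hf)

theorem FrolicherSpace.continuous_from_curvTop (X : FrolicherSpace) {Y : Type}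
    [TopologicalSpace Y] {h : X.carrier → Y} (hh : ∀ c ∈ X.curves, Continuous (h ∘ c)) :
    @Continuous _ _ X.curvTop _ h := by
  rw [continuous_iff_coinduced_le]
  unfold FrolicherSpace.curvTop
  simp only [coinduced_iSup, coinduced_compose]
  exact iSup₂_le fun c hc => continuous_iff_coinduced_le.1 (hh c hc)

theorem FrolicherSpace.continuous_to_funcTop (X : FrolicherSpace) {Y : Type}
    [TopologicalSpace Y] {h : Y → X.carrier} (hh : ∀ f ∈ X.functionals, Continuous (f ∘ h)) :
    @Continuous _ _ _ X.funcTop h := by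
  rw [continuous_iff_le_induced]
  unfold FrolicherSpace.funcTop
  simp only [induced_iInf, induced_compose]
  exact le_iInf₂ fun f hf => continuous_iff_le_induced.1 (hh f hf)

/-- If all curves of a Frölicher space are continuous, a continuous function which is smooth
on all continuous smooth plots is a functional. -/
theorem FrolicherSpace.smithClosure_subset (X : FrolicherSpace) (t : TopologicalSpace X.carrier)
    (ht : ∀ c ∈ X.curves, Continuous c) : smithClosure X.functionals ⊆ X.functionals := by
  rintro g ⟨-, hg⟩
  refine (X.mem_functionals_iff g).2 fun c hc => ?_
  have hproj : ContDiff ℝ ∞ (fun v : Euc 1 => v 0) := by fun_prop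
  have hinj : ContDiff ℝ ∞ (fun s : ℝ => (WithLp.toLp 2 fun _ => s : Euc 1)) := by fun_prop
  obtain ⟨k, hk, hkg⟩ := hg 1 Set.univ isOpen_univ (fun v => c (v.1 0))
    ⟨(ht c hc).comp (hproj.continuous.comp continuous_subtype_val), fun f hf =>
      ⟨fun v => f (c (v 0)),
        (((X.mem_curves_iff c).1 hc f hf).comp hproj).contDiffOn, fun _ => rfl⟩⟩
  have h1 : g ∘ c = fun s : ℝ => k (WithLp.toLp 2 fun _ => s : Euc 1) := by
    funext s
    exact (hkg ⟨(WithLp.toLp 2 fun _ => s : Euc 1), trivial⟩).symm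
  rw [h1]
  exact (contDiffOn_univ.1 hk).comp hinj

/-- Frölicher to Smith with the curvaceous topology. -/
def FrSmCurv : FrolicherSpace ⥤ SmithSpace where
  obj X :=
    { carrier := X.carrier
      top := X.curvTop
      functionals := X.functionals
      continuous_of_mem := fun f hf => X.continuous_from_curvTop fun c hc =>
        ((X.mem_curves_iff c).1 hc f hf).continuous
      closure_subset := X.smithClosure_subset X.curvTop fun _ hc => X.continuous_curv hc }
  map {X Y} h := @SmithSpace.Hom.mk _ _ h.toFun
    (@FrolicherSpace.continuous_from_curvTop X Y.carrier Y.curvTop h.toFun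
      fun c hc => Y.continuous_curv (h.mem_curves c hc))
    fun f hf => FrolicherSpace.Hom.mem_functionals h f hf

/-- Frölicher to Smith with the functional topology. -/
def FrSmFunc : FrolicherSpace ⥤ SmithSpace where
  obj X :=
    { carrier := X.carrier
      top := X.funcTop
      functionals := X.functionals
      continuous_of_mem := fun _ hf => X.continuous_func hf
      closure_subset := X.smithClosure_subset X.funcTop fun c hc =>
        X.continuous_to_funcTop fun f hf => ((X.mem_curves_iff c).1 hc f hf).continuous }
  map {X Y} h := @SmithSpace.Hom.mk _ _ h.toFun
    (@FrolicherSpace.continuous_to_funcTop Y X.carrier X.funcTop h.toFun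
      fun f hf => X.continuous_func (FrolicherSpace.Hom.mem_functionals h f hf))
    fun f hf => FrolicherSpace.Hom.mem_functionals h f hf

theorem SmoothMap.comp_left {n : ℕ} {A : Set (Euc n)} {V W : Type} [NormedAddCommGroup V]
    [NormedSpace ℝ V] [NormedAddCommGroup W] [NormedSpace ℝ W] {φ : A → V} (hφ : SmoothMap φ)
    {g : V → W} (hg : ContDiff ℝ ∞ g) : SmoothMap (g ∘ φ) := by
  obtain ⟨k, hk, hkφ⟩ := hφ
  exact ⟨g ∘ k, hg.comp_contDiffOn hk, fun x => congrArg g (hkφ x)⟩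

theorem SmoothMap.tuple {n : ℕ} {A : Set (Euc n)} {k : ℕ} {φ : Fin k → A → ℝ}
    (hφ : ∀ i, SmoothMap (φ i)) : SmoothMap (fun x => (WithLp.toLp 2 fun i => φ i x : Euc k)) := by
  choose g hg hgφ using hφ
  refine ⟨fun x => WithLp.toLp 2 fun i => g i x, ?_, fun x => ?_⟩
  · rw [contDiffOn_euclidean]
    exact hg
  · simp only [hgφ]

theorem SmithSpace.mem_of_forall (X : SmithSpace) {g : X.carrier → ℝ} (hg : Continuous g)
    (h : ∀ (n : ℕ) (U : Set (Euc n)), IsOpen U → ∀ φ : U → X.carrier,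
      ContSmooth X.functionals φ → SmoothMap (g ∘ φ)) : g ∈ X.functionals :=
  X.closure_subset ⟨hg, h⟩

theorem SmithSpace.tuple_mem (X : SmithSpace) (k : ℕ) (f : Fin k → X.carrier → ℝ)
    (hf : ∀ i, f i ∈ X.functionals) (g : Euc k → ℝ) (hg : ContDiff ℝ ∞ g) :
    (fun x => g (WithLp.toLp 2 fun i => f i x)) ∈ X.functionals := by
  refine X.mem_of_forall ?_ fun n U _ φ hφ => ?_
  · refine hg.continuous.comp ((PiLp.continuous_toLp 2 _).comp ?_)
    exact continuous_pi fun i => X.continuous_of_mem _ (hf i)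
  · exact (SmoothMap.tuple (φ := fun i => f i ∘ φ) fun i => hφ.2 _ (hf i)).comp_left hg

/-- Smith to Sikorski: a Smith space is a Sikorski space. -/
def SmSi : SmithSpace ⥤ SikorskiSpace where
  obj X :=
    { carrier := X.carrier
      top := X.top
      functionals :=
        { carrier := X.functionals
          mul_mem' := by
            intro a b ha hb
            have := X.tuple_mem 2 ![a, b] (by simp [Fin.forall_fin_two, ha, hb])
              (fun v => v 0 * v 1) (by fun_prop)
            exact this
          add_mem' := by
            intro a b ha hb
            have := X.tuple_mem 2 ![a, b] (by simp [Fin.forall_fin_two, ha, hb])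
              (fun v => v 0 + v 1) (by fun_prop)
            exact this
          algebraMap_mem' := fun r =>
            X.tuple_mem 0 Fin.elim0 (fun i => i.elim0) (fun _ => r) contDiff_const }
      continuous_of_mem := X.continuous_of_mem
      mem_of_local := by
        intro f hf
        refine X.mem_of_forall ?_ fun n U _ φ hφ => ?_
        · refine continuous_iff_continuousAt.2 fun x => ?_
          obtain ⟨V, hV, g, hg, hfg⟩ := hf x
          refine ((X.continuous_of_mem g hg).continuousAt).congr ?_
          filter_upwards [hV] with y hy using (hfg y hy).symm
        · refine SmoothMap.of_local fun x => ?_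
          obtain ⟨V, hV, g, hg, hfg⟩ := hf (φ x)
          have h1 : φ ⁻¹' V ∈ 𝓝 x := hφ.1.continuousAt.preimage_mem_nhds hV
          rw [nhds_subtype_eq_comap_nhdsWithin] at h1
          obtain ⟨S, hS, hSV⟩ := h1
          refine ⟨S ∩ U, Set.inter_subset_right,
            Filter.inter_mem hS self_mem_nhdsWithin, ?_⟩
          obtain ⟨k, hk, hkg⟩ := hφ.2 g hg
          refine ⟨k, hk.mono Set.inter_subset_right, fun y => ?_⟩
          rw [hkg ⟨y, y.2.2⟩]
          exact (hfg _ (hSV (show ((⟨y, y.2.2⟩ : U) : Euc n) ∈ S from y.2.1))).symm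
      comp_mem := X.tuple_mem }
  map h := ⟨h.toFun, h.cont, h.mem_functionals⟩

theorem smithClosure_idem {X : Type} [TopologicalSpace X] {F : Set (X → ℝ)} :
    smithClosure (smithClosure F) ⊆ smithClosure F :=
  fun _ hg => ⟨hg.1, fun n U hU φ hφ => hg.2 n U hU φ
    ⟨hφ.1, fun _ hf => hf.2 n U hU φ hφ⟩⟩

/-- Sikorski to Smith: keep the topology and close up the functionals. -/
def SiSm : SikorskiSpace ⥤ SmithSpace where
  obj X :=
    { carrier := X.carrier
      top := X.top
      functionals := smithClosure (X.functionals : Set (X.carrier → ℝ))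
      continuous_of_mem := fun _ hf => hf.1
      closure_subset := smithClosure_idem }
  map h := ⟨h.toFun, h.cont, fun _ hf => ⟨hf.1.comp h.cont, fun n U hU φ hφ =>
    hf.2 n U hU (h.toFun ∘ φ) ⟨h.cont.comp hφ.1, fun u hu => hφ.2 _ (h.mem_functionals u hu)⟩⟩⟩

/-!
The units and counits of the four adjunctions are identity maps on underlying sets, and the only one
which is not formal is the unit of `SoFr ⊣ FrSo`: a function on an open set which is smooth along all
smooth curves has to be smooth. This is Boman's theorem, `contDiffOn_of_comp_curves`. By a special
curve lemma (`exists_special_curve`), fast convergent sequences of points, with directions, lie on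
smooth curves; hence a function `f` which is smooth along smooth curves is continuous and has locally
bounded directional derivatives of all orders, uniformly over unit directions. After multiplication
with a bump function, the `p`-th differences of `f` with step `h v` are `O(|h|ᵖ)`. The difference
operator with step `v / (2‖ξ‖)`, `v = ξ / ‖ξ‖`, multiplies the Fourier transform at `ξ` by `-2`, so
the Fourier transform of `f` decays rapidly, and Fourier inversion shows that `f` is smooth.

Adjoint functors preserve limits or colimits, so everything else is a matter of finding limits and
colimits which are not preserved. Three mechanisms produce them, each exploiting that some space has
few smooth maps in one direction only.

* *Totally disconnected spaces.* Smooth curves and plots in `ℚ` are locally constant, so all functions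
  on `ℚ` are smooth along them. But `ℚ` is a subspace of spaces with few functions: of the line,
  and of `WithGeneric ℚ`, in which an added point is dense and on which continuous functions
  are constant. It is an equalizer there, and `SoFr`, `SmFr`, `SmSi`, and both functors from
  Frölicher to Smith spaces fail to preserve it. Dually, the unit interval is a quotient of the Cantor
  space, which `SiSm` does not preserve.
* *The Sierpiński space.* Identifying all nonzero points of the line (or of `ℚ`), one obtains two points
  which no continuous real function separates. In the categories defined by functions the quotient is
  indiscrete; in the categories which see plots or open sets it is not. This refutes preservation of
  colimits by `FrSo`, `SmFr`, and both functors from Frölicher to Smith spaces.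
* *A convex set which is not locally compact.* A map from an open subset of a Euclidean space locally
  factors through a compact set, but the identity of the open half plane with the origin added, which is
  convex, does not. Hence this set with its standard Souriau structure does not stay a subspace of the
  plane under `SoChMin`, and the colimit of its compact subsets, taken as indiscrete spaces, is not
  preserved by `SoChMax`.
-/

/-! ### Boman's theorem -/

section Boman

variable {E F : Type} [NormedAddCommGroup E] [NormedSpace ℝ E] [NormedAddCommGroup F]

/-- The derivatives up to order `k` of a smooth function of compact support on the line have a common
bound. -/
theorem exists_bound_iteratedFDeriv {a : ℝ → ℝ} (ha : ContDiff ℝ ∞ a) (hs : HasCompactSupport a)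
    (k : ℕ) : ∃ M : ℝ, ∀ j ≤ k, ∀ t, ‖iteratedFDeriv ℝ j a t‖ ≤ M := by
  have h : ∀ j : ℕ, ∃ M : ℝ, ∀ t, ‖iteratedFDeriv ℝ j a t‖ ≤ M := fun j =>
    (hs.iteratedFDeriv j).exists_bound_of_continuous
      (ha.continuous_iteratedFDeriv (mod_cast le_top))
  choose M hM using h
  refine ⟨∑ j ∈ Finset.range (k + 1), |M j|, fun j hj t => ?_⟩
  exact ((hM j t).trans (le_abs_self _)).trans
    (Finset.single_le_sum (f := fun j => |M j|) (fun _ _ => abs_nonneg _)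
      (Finset.mem_range.2 (Nat.lt_succ_of_le hj)))

theorem norm_iteratedFDeriv_smul_const_le {a : ℝ → ℝ} (ha : ContDiff ℝ ∞ a) (u : E) (j : ℕ)
    (t : ℝ) : ‖iteratedFDeriv ℝ j (fun t => a t • u) t‖ ≤ ‖u‖ * ‖iteratedFDeriv ℝ j a t‖ := by
  have h := ((1 : ℝ →L[ℝ] ℝ).smulRight u).norm_iteratedFDeriv_comp_left (x := t) (n := j)
    ha.contDiffAt (mod_cast le_top)
  rw [ContinuousLinearMap.norm_smulRight_apply, norm_one, one_mul] at h
  exact h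

/-- The bump function at `2⁻ᵏ` used to build curves through a sequence of points. -/
noncomputable def dyadicBump (k : ℕ) : ContDiffBump ((1 / 2 : ℝ) ^ k) :=
  ⟨(1 / 2) ^ k / 8, (1 / 2) ^ k / 4, by positivity, by
    have : (0 : ℝ) < (1 / 2) ^ k := by positivity
    linarith⟩

theorem dyadicBump_eq_one {k : ℕ} {t : ℝ} (ht : |t - (1 / 2) ^ k| ≤ (1 / 2) ^ k / 8) :
    dyadicBump k t = 1 :=
  (dyadicBump k).one_of_mem_closedBall (by rwa [Metric.mem_closedBall, Real.dist_eq])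

theorem dyadicBump_eq_zero {k : ℕ} {t : ℝ} (ht : (1 / 2) ^ k / 4 ≤ |t - (1 / 2) ^ k|) :
    dyadicBump k t = 0 :=
  (dyadicBump k).zero_of_le_dist (by rwa [Real.dist_eq])

theorem dyadicBump_eq_zero_of_ne {k m : ℕ} (hmk : m ≠ k) {t : ℝ}
    (ht : |t - (1 / 2) ^ k| ≤ (1 / 2) ^ k / 8) : dyadicBump m t = 0 := by
  apply dyadicBump_eq_zero
  have hm : (0 : ℝ) < (1 / 2) ^ m := by positivity
  have hk : (0 : ℝ) < (1 / 2) ^ k := by positivity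
  rw [abs_le] at ht
  rcases lt_or_gt_of_ne hmk with h | h
  · have h1 : ((1 : ℝ) / 2) ^ k ≤ (1 / 2) ^ (m + 1) :=
      pow_le_pow_of_le_one (by norm_num) (by norm_num) h
    rw [pow_succ] at h1
    rw [le_abs]
    right
    linarith
  · have h1 : ((1 : ℝ) / 2) ^ m ≤ (1 / 2) ^ (k + 1) :=
      pow_le_pow_of_le_one (by norm_num) (by norm_num) h
    rw [pow_succ] at h1
    rw [le_abs]
    left
    linarith

/-- Special curve lemma: if the points `y k` converge to `x` fast enough (how fast does not depend
on the data), some smooth curve passes through all of them at the times `2⁻ᵏ`, with prescribed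
direction `v k` and a speed `ε k` which does not depend on the data either. -/
theorem exists_special_curve (E : Type) [NormedAddCommGroup E] [NormedSpace ℝ E] [CompleteSpace E] :
    ∃ ε η : ℕ → ℝ, (∀ k, 0 < ε k) ∧ (∀ k, 0 < η k) ∧
      ∀ (x : E) (y v : ℕ → E), (∀ k, ‖y k - x‖ ≤ η k) → (∀ k, ‖v k‖ ≤ 1) →
        ∃ c : ℝ → E, ContDiff ℝ ∞ c ∧ c 0 = x ∧
          ∀ k, ∀ᶠ t in 𝓝 ((1 / 2 : ℝ) ^ k), c t = y k + (ε k * (t - (1 / 2) ^ k)) • v k := by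
  set a : ℕ → ℝ → ℝ := fun k t => dyadicBump k t with ha_def
  set b : ℕ → ℝ → ℝ := fun k t => dyadicBump k t * (t - (1 / 2) ^ k) with hb_def
  have ha : ∀ k, ContDiff ℝ ∞ (a k) := fun k => (dyadicBump k).contDiff
  have hb : ∀ k, ContDiff ℝ ∞ (b k) := fun k => (dyadicBump k).contDiff.mul (by fun_prop)
  choose A hA using fun k => exists_bound_iteratedFDeriv (ha k) (dyadicBump k).hasCompactSupport k
  choose B hB using fun k => exists_bound_iteratedFDeriv (hb k)
    ((dyadicBump k).hasCompactSupport.mul_right) k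
  -- with these weights the `k`-th summand of the curve has derivatives of order at most `k` bounded
  -- by `2 * 2⁻ᵏ`
  set M : ℕ → ℝ := fun k => 1 + |A k| + |B k| with hM_def
  have hM : ∀ k, 0 < M k := fun k => by positivity
  have hpos : ∀ k, 0 < (1 / 2 : ℝ) ^ k / M k := fun k => div_pos (by positivity) (hM k)
  refine ⟨fun k => (1 / 2) ^ k / M k, fun k => (1 / 2) ^ k / M k, hpos, hpos, ?_⟩
  intro x y v hy hv
  set g : ℕ → ℝ → E := fun k t =>
    a k t • (y k - x) + b k t • (((1 / 2 : ℝ) ^ k / M k) • v k) with hg_def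
  have hg : ∀ k, ContDiff ℝ ∞ (g k) := fun k =>
    ((ha k).smul contDiff_const).add ((hb k).smul contDiff_const)
  have hbound : ∀ k j, j ≤ k → ∀ t, ‖iteratedFDeriv ℝ j (g k) t‖ ≤ 2 * (1 / 2 : ℝ) ^ k := by
    intro k j hjk t
    have h1 : iteratedFDeriv ℝ j (g k) t = iteratedFDeriv ℝ j (fun t => a k t • (y k - x)) t +
        iteratedFDeriv ℝ j (fun t => b k t • (((1 / 2 : ℝ) ^ k / M k) • v k)) t :=
      iteratedFDeriv_add_apply (((ha k).smul contDiff_const).of_le (mod_cast le_top)).contDiffAt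
        (((hb k).smul contDiff_const).of_le (mod_cast le_top)).contDiffAt
    rw [h1]
    have h2 := norm_iteratedFDeriv_smul_const_le (ha k) (y k - x) j t
    have h3 := norm_iteratedFDeriv_smul_const_le (hb k) (((1 / 2 : ℝ) ^ k / M k) • v k) j t
    have hAM : A k ≤ M k := by
      have := le_abs_self (A k); have := abs_nonneg (B k); simp only [hM_def]; linarith
    have hBM : B k ≤ M k := by
      have := le_abs_self (B k); have := abs_nonneg (A k); simp only [hM_def]; linarith
    have h4 : ‖y k - x‖ * ‖iteratedFDeriv ℝ j (a k) t‖ ≤ (1 / 2 : ℝ) ^ k / M k * M k :=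
      mul_le_mul (hy k) ((hA k j hjk t).trans hAM) (norm_nonneg _) (hpos k).le
    have h5 : ‖((1 / 2 : ℝ) ^ k / M k) • v k‖ * ‖iteratedFDeriv ℝ j (b k) t‖
        ≤ (1 / 2 : ℝ) ^ k / M k * M k := by
      refine mul_le_mul ?_ ((hB k j hjk t).trans hBM) (norm_nonneg _) (hpos k).le
      rw [norm_smul, Real.norm_of_nonneg (hpos k).le]
      exact mul_le_of_le_one_right (hpos k).le (hv k)
    rw [div_mul_cancel₀ _ (hM k).ne'] at h4 h5
    calc _ ≤ _ := norm_add_le _ _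
      _ ≤ (1 / 2 : ℝ) ^ k + (1 / 2 : ℝ) ^ k := add_le_add (h2.trans h4) (h3.trans h5)
      _ = _ := by ring
  refine ⟨fun t => x + ∑' k, g k t, contDiff_const.add ?_, ?_, ?_⟩
  · refine contDiff_tsum_of_eventually (v := fun _ k => 2 * (1 / 2 : ℝ) ^ k) hg
      (fun _ _ => summable_geometric_two.mul_left 2) fun j _ => ?_
    rw [Nat.cofinite_eq_atTop]
    filter_upwards [Filter.eventually_ge_atTop j] with k hk using hbound k j hk
  · have h0 : ∀ k, g k 0 = 0 := by
      intro k
      have : dyadicBump k 0 = 0 := by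
        apply dyadicBump_eq_zero
        have hk : (0 : ℝ) < (1 / 2) ^ k := by positivity
        rw [zero_sub, abs_neg, abs_of_pos hk]
        linarith
      simp [hg_def, ha_def, hb_def, this]
    simp [h0]
  · intro k
    have hk : (0 : ℝ) < (1 / 2) ^ k / 8 := by positivity
    filter_upwards [Metric.closedBall_mem_nhds _ hk] with t ht
    rw [Metric.mem_closedBall, Real.dist_eq] at ht
    have h1 : ∑' m, g m t = g k t := by
      refine tsum_eq_single k fun m hm => ?_
      simp [hg_def, ha_def, hb_def, dyadicBump_eq_zero_of_ne hm ht]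
    rw [h1]
    simp only [hg_def, ha_def, hb_def, dyadicBump_eq_one ht, one_smul, one_mul, smul_smul]
    rw [mul_comm (t - (1 / 2) ^ k)]
    abel

theorem iterate_fwdDiff_line (f : E → F) (x v : E) (h : ℝ) (p : ℕ) (s : ℝ) :
    (fwdDiff (h • v))^[p] f (x + s • v) = (fwdDiff h)^[p] (fun s => f (x + s • v)) s := by
  induction p generalizing s with
  | zero => rfl
  | succ p ih =>
    rw [Function.iterate_succ_apply', Function.iterate_succ_apply', fwdDiff, fwdDiff, ← ih, ← ih,
      add_smul, add_assoc]

theorem iterate_fwdDiff_eq_zero {E F : Type} [NormedAddCommGroup E]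
    [NormedAddCommGroup F] (p : ℕ) {w : E} (hw : ‖w‖ ≤ 1) :
    ∀ {f : E → F} {R : ℝ}, (∀ x, R < ‖x‖ → f x = 0) → ∀ x, R + p < ‖x‖ → (fwdDiff w)^[p] f x = 0 := by
  induction p with
  | zero => intro f R hf x hx; exact hf x (by simpa using hx)
  | succ p ih =>
    intro f R hf x hx
    rw [Function.iterate_succ_apply]
    refine ih (R := R + 1) (fun y hy => ?_) x (by push_cast at hx; linarith)
    have h1 : ‖y‖ ≤ ‖y + w‖ + ‖w‖ := by
      simpa using norm_sub_le (y + w) w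
    rw [fwdDiff, hf y (by linarith), hf (y + w) (by linarith), sub_zero]

variable [NormedSpace ℝ F]

/-- A function is continuous if it is smooth along smooth curves. -/
theorem continuous_of_comp_curves [CompleteSpace E] {f : E → F}
    (hf : ∀ c : ℝ → E, ContDiff ℝ ∞ c → ContDiff ℝ ∞ (f ∘ c)) : Continuous f := by
  refine continuous_iff_continuousAt.2 fun x => ?_
  by_contra hx
  rw [Metric.continuousAt_iff] at hx
  push Not at hx
  obtain ⟨δ, hδ, hx⟩ := hx
  obtain ⟨ε, η, -, hη, hc⟩ := exists_special_curve E
  choose y hy hy' using fun k => hx (η k) (hη k)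
  obtain ⟨c, hc, hc0, hck⟩ := hc x y 0 (fun k => by
    rw [← dist_eq_norm]; exact (hy k).le) (fun k => by simp)
  have h1 : Filter.Tendsto (fun k : ℕ => f (c ((1 / 2) ^ k))) Filter.atTop (𝓝 (f (c 0))) :=
    ((hf c hc).continuous.tendsto 0).comp
      (tendsto_pow_atTop_nhds_zero_of_lt_one (by norm_num) (by norm_num))
  obtain ⟨k, hk⟩ := ((Metric.tendsto_nhds.1 h1) δ hδ).exists
  have h2 : c ((1 / 2) ^ k) = y k := by simpa using (hck k).self_of_nhds
  rw [h2, hc0] at hk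
  exact absurd hk (not_lt.2 (hy' k))

/-- The directional derivatives of any order of a function which is smooth along smooth curves are
bounded near each point, uniformly over directions in the unit ball. -/
theorem exists_bound_directional [CompleteSpace E] {f : E → F}
    (hf : ∀ c : ℝ → E, ContDiff ℝ ∞ c → ContDiff ℝ ∞ (f ∘ c)) (p : ℕ) (x : E) :
    ∃ r > 0, ∃ M : ℝ, ∀ y ∈ Metric.closedBall x r, ∀ v : E, ‖v‖ ≤ 1 →
      ‖iteratedDeriv p (fun s : ℝ => f (y + s • v)) 0‖ ≤ M := by
  by_contra! hx
  obtain ⟨ε, η, hε, hη, hc⟩ := exists_special_curve E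
  -- the bound makes the `p`-th derivative of `f ∘ c` at `2⁻ᵏ` exceed `k`, where `c` has speed `ε k`
  choose y hy v hv hyv using fun k : ℕ => hx (η k) (hη k) (k / ε k ^ p)
  obtain ⟨c, hc, hc0, hck⟩ := hc x y v (fun k => by
    rw [← dist_eq_norm]; exact hy k) hv
  have hcont : Continuous (iteratedDeriv p (f ∘ c)) :=
    (hf c hc).continuous_iteratedDeriv p (mod_cast le_top)
  obtain ⟨C, hC⟩ := (isCompact_Icc (a := (0 : ℝ)) (b := 1)).exists_bound_of_continuousOn
    hcont.continuousOn
  obtain ⟨k, hk⟩ := exists_nat_gt C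
  have h1 : iteratedDeriv p (f ∘ c) ((1 / 2) ^ k) =
      ε k ^ p • iteratedDeriv p (fun s : ℝ => f (y k + s • v k)) 0 := by
    have hg : ContDiff ℝ ∞ (fun s : ℝ => f (y k + s • v k)) :=
      hf (fun s => y k + s • v k) (by fun_prop)
    have h2 : (f ∘ c) =ᶠ[𝓝 ((1 / 2 : ℝ) ^ k)]
        fun t => (fun u => (fun s : ℝ => f (y k + s • v k)) (ε k * u)) (t - (1 / 2) ^ k) := by
      filter_upwards [hck k] with t ht
      simp [ht]
    rw [h2.iteratedDeriv_eq]
    refine (congrFun (iteratedDeriv_comp_sub_const p (fun u => (fun s : ℝ => f (y k + s • v k))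
      (ε k * u)) ((1 / 2) ^ k)) _).trans ?_
    rw [sub_self]
    refine (congrFun (iteratedDeriv_comp_const_smul (n := p)
      (hg.of_le (mod_cast le_top)) (ε k)) 0).trans ?_
    rw [mul_zero]
  have h3 := hC ((1 / 2) ^ k) ⟨by positivity, pow_le_one₀ (by norm_num) (by norm_num)⟩
  rw [h1, norm_smul, Real.norm_of_nonneg (pow_pos (hε k) p).le] at h3
  have h4 := hyv k
  rw [div_lt_iff₀ (pow_pos (hε k) p)] at h4
  linarith

/-- For a compactly supported function the bounds of `exists_bound_directional` are global. -/
theorem exists_bound_directional_of_hasCompactSupport [CompleteSpace E] {f : E → F}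
    (hf : ∀ c : ℝ → E, ContDiff ℝ ∞ c → ContDiff ℝ ∞ (f ∘ c)) (hs : HasCompactSupport f) (p : ℕ) :
    ∃ M : ℝ, 0 ≤ M ∧ ∀ y v : E, ‖v‖ ≤ 1 →
      ‖iteratedDeriv p (fun s : ℝ => f (y + s • v)) 0‖ ≤ M := by
  have key : ∃ M : ℝ, 0 ≤ M ∧ ∀ y ∈ tsupport f, ∀ v : E, ‖v‖ ≤ 1 →
      ‖iteratedDeriv p (fun s : ℝ => f (y + s • v)) 0‖ ≤ M := by
    refine IsCompact.induction_on (p := fun S => ∃ M : ℝ, 0 ≤ M ∧ ∀ y ∈ S, ∀ v : E, ‖v‖ ≤ 1 →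
      ‖iteratedDeriv p (fun s : ℝ => f (y + s • v)) 0‖ ≤ M) hs ⟨0, le_rfl, by simp⟩ ?_ ?_ ?_
    · rintro S T hST ⟨M, hM, h⟩
      exact ⟨M, hM, fun y hy => h y (hST hy)⟩
    · rintro S T ⟨M, hM, h⟩ ⟨M', hM', h'⟩
      refine ⟨max M M', hM.trans (le_max_left _ _), fun y hy v hv => ?_⟩
      rcases hy with hy | hy
      · exact (h y hy v hv).trans (le_max_left _ _)
      · exact (h' y hy v hv).trans (le_max_right _ _)
    · intro x _
      obtain ⟨r, hr, M, hM⟩ := exists_bound_directional hf p x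
      exact ⟨_, mem_nhdsWithin_of_mem_nhds (Metric.closedBall_mem_nhds x hr), |M|, abs_nonneg M,
        fun y hy v hv => (hM y hy v hv).trans (le_abs_self M)⟩
  obtain ⟨M, hM, h⟩ := key
  refine ⟨M, hM, fun y v hv => ?_⟩
  by_cases hy : y ∈ tsupport f
  · exact h y hy v hv
  · have h1 : (fun s : ℝ => f (y + s • v)) =ᶠ[𝓝 0] fun _ => 0 := by
      have h2 : Filter.Tendsto (fun s : ℝ => y + s • v) (𝓝 0) (𝓝 y) := by
        have : Continuous (fun s : ℝ => y + s • v) := by fun_prop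
        simpa using this.tendsto 0
      exact h2.eventually (notMem_tsupport_iff_eventuallyEq.1 hy)
    rw [h1.iteratedDeriv_eq]
    simpa using hM

theorem norm_iterate_fwdDiff_le (p : ℕ) {M : ℝ} (h : ℝ) : ∀ {g : ℝ → F}, ContDiff ℝ ∞ g →
    (∀ s, ‖iteratedDeriv p g s‖ ≤ M) → ∀ s, ‖(fwdDiff h)^[p] g s‖ ≤ M * |h| ^ p := by
  induction p generalizing M with
  | zero => intro g _ hM s; simpa using hM s
  | succ p ih =>
    intro g hg hM s
    have hg' : ContDiff ℝ ∞ (fun s => g (s + h)) := hg.comp (by fun_prop)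
    have h1 : ∀ s, ‖iteratedDeriv p (fwdDiff h g) s‖ ≤ M * |h| := by
      intro s
      have h2 : iteratedDeriv p (fwdDiff h g) s = iteratedDeriv p g (s + h) - iteratedDeriv p g s := by
        have := iteratedDeriv_fun_sub (n := p) (x := s) (hg'.of_le (mod_cast le_top)).contDiffAt
          (hg.of_le (mod_cast le_top)).contDiffAt
        rw [iteratedDeriv_comp_add_const] at this
        exact this
      rw [h2]
      have h3 := convex_univ.norm_image_sub_le_of_norm_deriv_le (𝕜 := ℝ) (f := iteratedDeriv p g)
        (C := M) (x := s) (y := s + h)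
        (fun x _ => (hg.differentiable_iteratedDeriv p (mod_cast WithTop.coe_lt_top _)) x)
        (fun x _ => by rw [← iteratedDeriv_succ]; exact hM x) trivial trivial
      simpa using h3
    have h4 := ih (hg'.sub hg) h1 s
    rw [Function.iterate_succ_apply]
    calc _ ≤ _ := h4
      _ = _ := by ring

/-- Finite differences of a compactly supported function which is smooth along smooth curves. -/
theorem exists_bound_iterate_fwdDiff [CompleteSpace E] {f : E → F}
    (hf : ∀ c : ℝ → E, ContDiff ℝ ∞ c → ContDiff ℝ ∞ (f ∘ c)) (hs : HasCompactSupport f) (p : ℕ) :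
    ∃ M : ℝ, 0 ≤ M ∧ ∀ x v : E, ‖v‖ ≤ 1 → ∀ h : ℝ,
      ‖(fwdDiff (h • v))^[p] f x‖ ≤ M * |h| ^ p := by
  obtain ⟨M, hM, hD⟩ := exists_bound_directional_of_hasCompactSupport hf hs p
  refine ⟨M, hM, fun x v hv h => ?_⟩
  have h1 := norm_iterate_fwdDiff_le p (M := M) h (g := fun s : ℝ => f (x + s • v))
    (hf (fun s => x + s • v) (by fun_prop)) (fun s => ?_) 0
  · rw [← iterate_fwdDiff_line] at h1
    simpa using h1
  · have h2 := hD (x + s • v) v hv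
    have h3 : (fun t : ℝ => f (x + s • v + t • v)) = fun t => (fun s : ℝ => f (x + s • v)) (s + t) := by
      funext t
      simp only [add_smul, add_assoc]
    rw [h3, congrFun (iteratedDeriv_comp_const_add p (fun s : ℝ => f (x + s • v)) s) 0,
      add_zero] at h2
    exact h2

end Boman

section BomanFourier

open MeasureTheory
open scoped FourierTransform

variable {E : Type} [NormedAddCommGroup E] [InnerProductSpace ℝ E] [FiniteDimensional ℝ E]
  [MeasurableSpace E] [BorelSpace E]

theorem integrable_fwdDiff {g : E → ℂ} (hg : Integrable g) (w : E) : Integrable (fwdDiff w g) :=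
  (hg.comp_add_right w).sub hg

theorem fourier_fwdDiff {g : E → ℂ} (hg : Integrable g) (w ξ : E) :
    𝓕 (fwdDiff w g) ξ = ((𝐞 (inner ℝ w ξ) : ℂ) - 1) * 𝓕 g ξ := by
  have h1 : 𝓕 (fwdDiff w g) ξ = 𝓕 (g ∘ fun x => x + w) ξ - 𝓕 g ξ := by
    simp only [Real.fourier_eq]
    rw [← integral_sub]
    · refine integral_congr_ae (Filter.Eventually.of_forall fun x => ?_)
      simp [fwdDiff, smul_sub]
    · exact (Real.fourierIntegral_convergent_iff ξ).2 (hg.comp_add_right w)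
    · exact (Real.fourierIntegral_convergent_iff ξ).2 hg
  have h2 : 𝓕 (g ∘ fun x => x + w) ξ = (𝐞 (inner ℝ w ξ) : ℂ) * 𝓕 g ξ :=
    congrFun (VectorFourier.fourierIntegral_comp_add_right 𝐞 volume (innerₗ E) g w) ξ
  rw [h1, h2]
  ring

/-- If `⟪w, ξ⟫ = 1 / 2`, the difference operator with step `w` multiplies the Fourier transform at
`ξ` by `-2`. -/
theorem fourier_iterate_fwdDiff {w ξ : E} (hw : inner ℝ w ξ = (1 / 2 : ℝ)) (p : ℕ) :
    ∀ {g : E → ℂ}, Integrable g → 𝓕 ((fwdDiff w)^[p] g) ξ = (-2) ^ p * 𝓕 g ξ := by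
  induction p with
  | zero => intro g _; simp
  | succ p ih =>
    intro g hg
    rw [Function.iterate_succ_apply, ih (integrable_fwdDiff hg w), fourier_fwdDiff hg, hw]
    have h1 : (𝐞 (1 / 2 : ℝ) : ℂ) = -1 := by
      rw [Real.fourierChar_apply, ← Complex.exp_pi_mul_I]
      congr 2
      push_cast
      ring
    rw [h1]
    ring

/-- The Fourier transform of a compactly supported function which is smooth along smooth curves
decays rapidly. -/
theorem exists_bound_pow_mul_fourier {f : E → ℂ}
    (hf : ∀ c : ℝ → E, ContDiff ℝ ∞ c → ContDiff ℝ ∞ (f ∘ c)) (hs : HasCompactSupport f) (p : ℕ) :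
    ∃ C : ℝ, ∀ ξ : E, ‖ξ‖ ^ p * ‖𝓕 f ξ‖ ≤ C := by
  have hcont : Continuous f := continuous_of_comp_curves hf
  have hint : Integrable f := hcont.integrable_of_hasCompactSupport hs
  obtain ⟨M, hM, hD⟩ := exists_bound_iterate_fwdDiff hf hs p
  obtain ⟨R, hR⟩ := hs.isCompact.isBounded.subset_closedBall (0 : E)
  have hR' : ∀ x, R < ‖x‖ → f x = 0 := by
    intro x hx
    by_contra h
    have := hR (subset_tsupport f h)
    rw [mem_closedBall_zero_iff] at this
    linarith
  set V : ℝ := volume.real (Metric.closedBall (0 : E) (R + p)) with hV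
  have hV0 : 0 ≤ V := measureReal_nonneg
  refine ⟨max (∫ x, ‖f x‖) (M * V), fun ξ => ?_⟩
  rcases le_total ‖ξ‖ 1 with h1 | h1
  · refine le_trans ?_ (le_max_left _ _)
    refine (mul_le_of_le_one_left (norm_nonneg _) (pow_le_one₀ (norm_nonneg _) h1)).trans ?_
    exact VectorFourier.norm_fourierIntegral_le_integral_norm _ _ _ _ _
  · refine le_trans ?_ (le_max_right _ _)
    have hξ : 0 < ‖ξ‖ := by linarith
    -- the step for which the Fourier multiplier of the difference operator at `ξ` is `-2`
    set h : ℝ := 1 / (2 * ‖ξ‖) with hh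
    set v : E := ‖ξ‖⁻¹ • ξ with hv
    have hv1 : ‖v‖ = 1 := by rw [hv, norm_smul, norm_inv, norm_norm, inv_mul_cancel₀ hξ.ne']
    have hh0 : 0 < h := by positivity
    have hh1 : h ≤ 1 := by
      rw [hh, div_le_one (by positivity)]
      linarith
    have hw1 : ‖h • v‖ ≤ 1 := by
      rw [norm_smul, hv1, mul_one, Real.norm_of_nonneg hh0.le]
      exact hh1
    have hwξ : inner ℝ (h • v) ξ = (1 / 2 : ℝ) := by
      rw [hv, inner_smul_left, inner_smul_left, real_inner_self_eq_norm_sq, hh]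
      simp only [conj_trivial]
      field_simp
    have h2 := fourier_iterate_fwdDiff hwξ p hint
    have h3 : ‖𝓕 ((fwdDiff (h • v))^[p] f) ξ‖ ≤ ∫ x, ‖(fwdDiff (h • v))^[p] f x‖ :=
      VectorFourier.norm_fourierIntegral_le_integral_norm _ _ _ _ _
    have h4 : ∫ x, ‖(fwdDiff (h • v))^[p] f x‖ ≤ M * |h| ^ p * V := by
      rw [← setIntegral_eq_integral_of_forall_compl_eq_zero
        (s := Metric.closedBall (0 : E) (R + p))]
      · have h5 := norm_setIntegral_le_of_norm_le_const (μ := volume)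
          (s := Metric.closedBall (0 : E) (R + p)) (f := fun x => ‖(fwdDiff (h • v))^[p] f x‖)
          (C := M * |h| ^ p) measure_closedBall_lt_top
          (fun x _ => by rw [norm_norm]; exact hD x v hv1.le h)
        exact (le_abs_self _).trans h5
      · intro x hx
        rw [mem_closedBall_zero_iff, not_le] at hx
        rw [iterate_fwdDiff_eq_zero p hw1 hR' x hx, norm_zero]
    rw [h2, norm_mul, norm_pow, norm_neg] at h3
    have h6 : (2 : ℝ) ^ p * ‖𝓕 f ξ‖ ≤ M * V * h ^ p := by
      have := h3.trans h4
      rw [abs_of_pos hh0] at this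
      calc _ ≤ _ := by simpa using this
        _ = _ := by ring
    have h7 : h ^ p * (2 ^ p * ‖ξ‖ ^ p) = 1 := by
      rw [← mul_pow, ← mul_pow, hh, one_div_mul_cancel (by positivity), one_pow]
    have h8 : (1 : ℝ) ≤ 2 ^ p := one_le_pow₀ (by norm_num)
    calc ‖ξ‖ ^ p * ‖𝓕 f ξ‖ ≤ (2 ^ p * ‖ξ‖ ^ p) * (2 ^ p * ‖𝓕 f ξ‖) := by
          have : 0 ≤ ‖ξ‖ ^ p * ‖𝓕 f ξ‖ := by positivity
          nlinarith [mul_le_mul_of_nonneg_right (mul_le_mul h8 h8 zero_le_one (by positivity)) this]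
      _ ≤ (2 ^ p * ‖ξ‖ ^ p) * (M * V * h ^ p) := by gcongr
      _ = M * V * (h ^ p * (2 ^ p * ‖ξ‖ ^ p)) := by ring
      _ = M * V := by rw [h7, mul_one]

/-- Boman's theorem for compactly supported functions, by Fourier inversion: the inverse transform of
a rapidly decreasing function is smooth. -/
theorem contDiff_of_hasCompactSupport_of_comp_curves {f : E → ℂ}
    (hf : ∀ c : ℝ → E, ContDiff ℝ ∞ c → ContDiff ℝ ∞ (f ∘ c)) (hs : HasCompactSupport f) :
    ContDiff ℝ ∞ f := by
  have hcont : Continuous f := continuous_of_comp_curves hf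
  have hint : Integrable f := hcont.integrable_of_hasCompactSupport hs
  have hFcont : Continuous (𝓕 f) :=
    VectorFourier.fourierIntegral_continuous Real.continuous_fourierChar
      (by exact continuous_inner) hint
  have hF : ∀ k : ℕ, Integrable (fun ξ => ‖ξ‖ ^ k * ‖𝓕 f ξ‖) := by
    intro k
    obtain ⟨C₁, h₁⟩ := exists_bound_pow_mul_fourier hf hs 0
    obtain ⟨C₂, h₂⟩ := exists_bound_pow_mul_fourier hf hs (k + (volume : Measure E).integrablePower)
    exact integrable_of_le_of_pow_mul_le (by simpa using h₁) h₂ hFcont.aestronglyMeasurable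
  have hF0 : Integrable (𝓕 f) := by
    have := hF 0
    simp only [pow_zero, one_mul] at this
    exact (integrable_norm_iff hFcont.aestronglyMeasurable).1 this
  rw [← hcont.fourierInv_fourier_eq hint hF0]
  have h1 : 𝓕⁻ (𝓕 f) = 𝓕 (𝓕 f) ∘ fun x => -x := by
    funext x
    exact Real.fourierInv_eq_fourier_neg _ _
  rw [h1]
  exact (Real.contDiff_fourier (N := ⊤) fun n _ => hF n).comp contDiff_neg

end BomanFourier

/-- Boman's theorem: a function on an open set is smooth if it is smooth along all smooth curves. -/
theorem contDiffOn_of_comp_curves {n : ℕ} {U : Set (Euc n)} (hU : IsOpen U) {f : Euc n → ℝ}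
    (hf : ∀ c : ℝ → Euc n, ContDiff ℝ ∞ c → (∀ t, c t ∈ U) → ContDiff ℝ ∞ (f ∘ c)) :
    ContDiffOn ℝ ∞ f U := by
  intro x hx
  refine ContDiffAt.contDiffWithinAt ?_
  obtain ⟨R, hR, hRU⟩ := Metric.isOpen_iff.1 hU x hx
  let χ : ContDiffBump x := ⟨R / 4, R / 2, by positivity, by linarith⟩
  have hχU : tsupport χ ⊆ U := by
    rw [χ.tsupport_eq]
    exact (Metric.closedBall_subset_ball (show R / 2 < R by linarith)).trans hRU
  have key : ContDiff ℝ ∞ (fun y => ((χ y * f y : ℝ) : ℂ)) := by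
    refine contDiff_of_hasCompactSupport_of_comp_curves (fun c hc => ?_) ?_
    · refine contDiff_iff_contDiffAt.2 fun t => ?_
      by_cases ht : c t ∈ tsupport χ
      · obtain ⟨δ, hδ, hδU⟩ := Metric.isOpen_iff.1 (hU.preimage hc.continuous) t (hχU ht)
        -- reparametrize `c` near `t` to stay in `U`
        let β : ContDiffBump t := ⟨δ / 4, δ / 2, by positivity, by linarith⟩
        set ρ : ℝ → ℝ := fun s => t + β s * (s - t) with hρ
        have hρs : ContDiff ℝ ∞ ρ := contDiff_const.add (β.contDiff.mul (by fun_prop))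
        have hρU : ∀ s, c (ρ s) ∈ U := by
          intro s
          refine hδU ?_
          rw [Metric.mem_ball, Real.dist_eq, hρ, add_sub_cancel_left, abs_mul,
            abs_of_nonneg β.nonneg]
          rcases le_or_gt (δ / 2) (dist s t) with h | h
          · rw [β.zero_of_le_dist h, zero_mul]
            exact hδ
          · rw [Real.dist_eq] at h
            have := mul_le_of_le_one_left (abs_nonneg (s - t)) (β.le_one (x := s))
            linarith
        have h1 : ContDiff ℝ ∞ (fun s => ((χ (c (ρ s)) * f (c (ρ s)) : ℝ) : ℂ)) :=
          Complex.ofRealCLM.contDiff.comp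
            ((χ.contDiff.comp (hc.comp hρs)).mul (hf (c ∘ ρ) (hc.comp hρs) hρU))
        refine h1.contDiffAt.congr_of_eventuallyEq ?_
        filter_upwards [Metric.closedBall_mem_nhds t (show (0 : ℝ) < δ / 4 by positivity)] with s hs
        have : ρ s = s := by
          rw [hρ]
          simp only
          rw [β.one_of_mem_closedBall hs]
          ring
        simp only [Function.comp_apply, this]
      · refine (contDiffAt_const (c := (0 : ℂ))).congr_of_eventuallyEq ?_
        filter_upwards [hc.continuous.tendsto t
          (notMem_tsupport_iff_eventuallyEq.1 ht)] with s hs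
        have hs' : χ (c s) = 0 := hs
        simp [hs']
    · refine HasCompactSupport.of_support_subset_isCompact χ.hasCompactSupport ?_
      refine subset_trans (fun y hy => ?_) (subset_tsupport χ)
      intro h
      exact hy (by simp [h])
  have h2 : ContDiff ℝ ∞ (fun y => χ y * f y) := by
    have := Complex.reCLM.contDiff.comp key
    exact this
  refine h2.contDiffAt.congr_of_eventuallyEq ?_
  filter_upwards [Metric.closedBall_mem_nhds x (show (0 : ℝ) < R / 4 by positivity)] with y hy
  rw [χ.one_of_mem_closedBall hy, one_mul]

/-! ### Smooth maps on open sets -/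

theorem SmoothMap.contDiff_comp {n : ℕ} {A : Set (Euc n)} {V W : Type} [NormedAddCommGroup V]
    [NormedSpace ℝ V] [NormedAddCommGroup W] [NormedSpace ℝ W] {φ : A → V} (hφ : SmoothMap φ)
    {c : W → A} (hc : ContDiff ℝ ∞ (fun t => (c t : Euc n))) : ContDiff ℝ ∞ (φ ∘ c) := by
  obtain ⟨g, hg, hgφ⟩ := hφ
  have h1 : φ ∘ c = g ∘ fun t => (c t : Euc n) := funext fun t => (hgφ (c t)).symm
  rw [h1]
  exact hg.comp_contDiff hc fun t => (c t).2

theorem ContDiff.smoothMap {n : ℕ} {A : Set (Euc n)} {V : Type} [NormedAddCommGroup V]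
    [NormedSpace ℝ V] {g : Euc n → V} (hg : ContDiff ℝ ∞ g) : SmoothMap (fun x : A => g x) :=
  ⟨g, hg.contDiffOn, fun _ => rfl⟩

/-- Boman's theorem in terms of `SmoothMap`. -/
theorem smoothMap_of_comp_curves {n : ℕ} {U : Set (Euc n)} (hU : IsOpen U) {g : U → ℝ}
    (hg : ∀ c : ℝ → U, ContDiff ℝ ∞ (fun t => (c t : Euc n)) → ContDiff ℝ ∞ (g ∘ c)) :
    SmoothMap g := by
  classical
  refine ⟨fun x => if hx : x ∈ U then g ⟨x, hx⟩ else 0,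
    contDiffOn_of_comp_curves hU fun c hc hcU => ?_, fun x => by simp⟩
  have h1 : (fun x => if hx : x ∈ U then g ⟨x, hx⟩ else 0) ∘ c = g ∘ fun t => ⟨c t, hcU t⟩ :=
    funext fun t => dif_pos (hcU t)
  rw [h1]
  exact hg (fun t => ⟨c t, hcU t⟩) hc

/-- A curve as a map on the Euclidean space `ℝ¹`. -/
theorem ContDiff.smoothMap_coord {V : Type} [NormedAddCommGroup V] [NormedSpace ℝ V] {g : ℝ → V}
    (hg : ContDiff ℝ ∞ g) : SmoothMap (fun v : (Set.univ : Set (Euc 1)) => g (v.1 0)) :=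
  ContDiff.smoothMap (g := fun v : Euc 1 => g (v 0)) (hg.comp (by fun_prop))

theorem continuous_of_continuous_coord {Y : Type} [TopologicalSpace Y] {g : ℝ → Y}
    (hg : Continuous fun v : (Set.univ : Set (Euc 1)) => g (v.1 0)) : Continuous g :=
  hg.comp (show Continuous fun t : ℝ =>
    (⟨WithLp.toLp 2 fun _ => t, trivial⟩ : (Set.univ : Set (Euc 1))) by fun_prop)

theorem map_nhds_inclusion {Y : Type} [TopologicalSpace Y] {A B : Set Y} (h : B ⊆ A) (x : A)
    (hB : B ∈ 𝓝[A] (x : Y)) :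
    Filter.map (Set.inclusion h) (𝓝 ⟨x, mem_of_mem_nhdsWithin x.2 hB⟩) = 𝓝 x := by
  refine (Topology.IsEmbedding.inclusion h).isInducing.map_nhds_of_mem _ ?_
  rw [Set.range_inclusion, nhds_subtype_eq_comap_nhdsWithin]
  exact Filter.preimage_mem_comap hB

/-- A continuous map from an open set to a totally disconnected space is locally constant, so every
function becomes smooth after composition with it. -/
theorem smoothMap_comp_of_totallyDisconnected {n : ℕ} {U : Set (Euc n)} (hU : IsOpen U) {T : Type}
    [TopologicalSpace T] [TotallyDisconnectedSpace T] {φ : U → T} (hφ : Continuous φ) (g : T → ℝ) :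
    SmoothMap (g ∘ φ) := by
  refine SmoothMap.of_local fun x => ?_
  obtain ⟨r, hr, hrU⟩ := Metric.isOpen_iff.1 hU x x.2
  refine ⟨Metric.ball x r, hrU, mem_nhdsWithin_of_mem_nhds (Metric.ball_mem_nhds _ hr), ?_⟩
  have : PreconnectedSpace (Metric.ball (x : Euc n) r) :=
    Subtype.preconnectedSpace (convex_ball (x : Euc n) r).isPreconnected
  have h1 : ∀ y : Metric.ball (x : Euc n) r, (φ ∘ Set.inclusion hrU) y = φ x := fun y =>
    (isPreconnected_range (hφ.comp (continuous_inclusion hrU))).subsingleton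
      ⟨y, rfl⟩ ⟨⟨x, Metric.mem_ball_self hr⟩, rfl⟩
  have h2 : (g ∘ φ) ∘ Set.inclusion hrU = fun _ => g (φ x) := funext fun y => congrArg g (h1 y)
  rw [h2]
  exact SmoothMap.const _

/-! ### The adjunctions which exist -/

/-- The unit is a morphism by Boman's theorem. -/
def soFrAdjFrSo : SoFr ⊣ FrSo :=
  Adjunction.mkOfUnitCounit
    { unit :=
        { app := fun X => ⟨id, fun {n U φ} hφ => by
            have hU : IsOpen U := X.str.dom_of_isPlot hφ
            refine ⟨hU, fun f hf => smoothMap_of_comp_curves hU fun c hc => ?_⟩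
            exact hf (φ ∘ c) fun g hg => (hg hφ).contDiff_comp hc⟩
          naturality := fun _ _ _ => rfl }
      counit :=
        { app := fun Y => ⟨id, fun c hc => (Y.mem_curves_iff c).2 fun f hf =>
            hc f fun hp => hp.2 f hf⟩
          naturality := fun _ _ _ => rfl }
      left_triangle := rfl
      right_triangle := rfl }

/-- A plot of a Souriau space composed with a smooth map from a convex set is a plot of the minimal
Chen structure; conversely such plots are locally of this form. -/
def soChMinAdjChSo : SoChMin ⊣ ChSo :=
  Adjunction.mkOfUnitCounit
    { unit :=
        { app := fun X => ⟨id, fun {n U φ} hφ => by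
            refine ⟨X.str.dom_of_isPlot hφ, ⟨φ, fun {m D θ} hθ => ⟨hθ.1, fun x => ?_⟩⟩, rfl⟩
            exact ⟨D, subset_rfl, hθ.1, self_mem_nhdsWithin, n, U, φ, θ, hφ, hθ.2, rfl⟩⟩
          naturality := fun _ _ _ => rfl }
      counit :=
        { app := fun Y => ⟨id, fun {n A φ} hφ => by
            refine Y.str.isPlot_of_local hφ.1 fun x => ?_
            obtain ⟨B, hBA, hB, hBx, m, U, p, θ, ⟨-, h, rfl⟩, hθ, hfac⟩ := hφ.2 x
            refine ⟨B, hBA, hB, hBx, ?_⟩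
            exact (congrArg (fun q => Y.str.IsPlot q) hfac).mpr (h.isPlot ⟨hB, hθ⟩)⟩
          naturality := fun _ _ _ => rfl }
      left_triangle := rfl
      right_triangle := rfl }

/-- Every open set is covered by balls, which are test domains both for Chen and for Souriau
spaces. -/
def chSoAdjSoChMax : ChSo ⊣ SoChMax :=
  Adjunction.mkOfUnitCounit
    { unit :=
        { app := fun X => ⟨id, fun {n A φ} hφ => by
            refine ⟨X.str.dom_of_isPlot hφ, ⟨φ, fun {m U θ} hθ => ⟨hθ.1, ?_⟩⟩, rfl⟩
            exact ⟨⟨φ ∘ θ, fun {k D ψ} hψ =>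
              X.str.isPlot_comp (θ := θ ∘ ψ) hφ hψ.1 (SmoothMap.comp hθ.2 hψ.2)⟩, rfl⟩⟩
          naturality := fun _ _ _ => rfl }
      counit :=
        { app := fun Y => ⟨id, fun {n U φ} hφ => by
            obtain ⟨hU, h, rfl⟩ := hφ
            refine Y.str.isPlot_of_local hU fun x => ?_
            obtain ⟨r, hr, hrU⟩ := Metric.isOpen_iff.1 hU x x.2
            refine ⟨Metric.ball x r, hrU, Metric.isOpen_ball,
              mem_nhdsWithin_of_mem_nhds (Metric.ball_mem_nhds _ hr), ?_⟩
            -- a ball is both open and convex, so that it is a test domain of both kinds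
            obtain ⟨-, k, hk⟩ := h.isPlot (φ := Set.inclusion hrU)
              ⟨convex_ball _ _, SmoothMap.inclusion hrU⟩
            have h1 := k.isPlot (φ := id) ⟨Metric.isOpen_ball, SmoothMap.val⟩
            rw [hk] at h1
            exact h1⟩
          naturality := fun _ _ _ => rfl }
      left_triangle := rfl
      right_triangle := rfl }

/-- A continuous map to a Sikorski space which pulls functionals back to Smith functionals does so
for the closure as well, as Smith functionals are closed. -/
def smSiAdjSiSm : SmSi ⊣ SiSm :=
  Adjunction.mkOfUnitCounit
    { unit :=
        { app := fun X => ⟨id, continuous_id, fun _ hf => X.closure_subset hf⟩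
          naturality := fun _ _ _ => rfl }
      counit :=
        { app := fun Y => ⟨id, continuous_id, fun _ hf =>
            subset_smithClosure Y.continuous_of_mem hf⟩
          naturality := fun _ _ _ => rfl }
      left_triangle := rfl
      right_triangle := rfl }

/-! ### Preservation of equalizers and coequalizers -/

section Preservation

variable {C D : Type 1} [Category.{0} C] [Category.{0} D]

/-- A fork is an equalizer if its map is a monomorphism through which all maps equalizing the
parallel pair factor. -/
noncomputable def isLimitForkOfExists {A X Y : C} {f g : X ⟶ Y} {ι : A ⟶ X} (w : ι ≫ f = ι ≫ g)
    (hι : Mono ι) (h : ∀ {S : C} (t : S ⟶ X), t ≫ f = t ≫ g → ∃ l : S ⟶ A, l ≫ ι = t) :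
    IsLimit (Fork.ofι ι w) :=
  Fork.IsLimit.mk _ (fun s => (h s.ι s.condition).choose)
    (fun s => (h s.ι s.condition).choose_spec)
    (fun s _ hm => hι.right_cancellation _ _ (hm.trans (h s.ι s.condition).choose_spec.symm))

/-- A cofork is a coequalizer if its map is an epimorphism through which all maps coequalizing the
parallel pair factor. -/
noncomputable def isColimitCoforkOfExists {X Y Q : C} {f g : X ⟶ Y} {π : Y ⟶ Q}
    (w : f ≫ π = g ≫ π) (hπ : Epi π)
    (h : ∀ {S : C} (t : Y ⟶ S), f ≫ t = g ≫ t → ∃ l : Q ⟶ S, π ≫ l = t) :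
    IsColimit (Cofork.ofπ π w) :=
  Cofork.IsColimit.mk _ (fun s => (h s.π s.condition).choose)
    (fun s => (h s.π s.condition).choose_spec)
    (fun s _ hm => hπ.left_cancellation _ _ (hm.trans (h s.π s.condition).choose_spec.symm))

theorem exists_lift_of_preservesLimits {F : C ⥤ D} (hF : PreservesLimits F) {A X Y : C}
    {f g : X ⟶ Y} {ι : A ⟶ X} {w : ι ≫ f = ι ≫ g} (hl : IsLimit (Fork.ofι ι w)) {S : D}
    (t : S ⟶ F.obj X) (ht : t ≫ F.map f = t ≫ F.map g) : ∃ l : S ⟶ F.obj A, l ≫ F.map ι = t :=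
  ⟨_, (Fork.IsLimit.lift' (isLimitForkMapOfIsLimit F w hl) t ht).2⟩

theorem exists_desc_of_preservesColimits {F : C ⥤ D} (hF : PreservesColimits F) {X Y Q : C}
    {f g : X ⟶ Y} {π : Y ⟶ Q} {w : f ≫ π = g ≫ π} (hc : IsColimit (Cofork.ofπ π w)) {S : D}
    (t : F.obj Y ⟶ S) (ht : F.map f ≫ t = F.map g ≫ t) : ∃ l : F.obj Q ⟶ S, F.map π ≫ l = t :=
  ⟨_, (Cofork.IsColimit.desc' (isColimitCoforkMapOfIsColimit F w hc) t ht).2⟩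

theorem not_isRightAdjoint_of_not_preservesLimits {F : C ⥤ D} (h : ¬ PreservesLimits F) :
    ¬ PreservesLimits F ∧ ¬ F.IsRightAdjoint :=
  ⟨h, fun _ => h (Adjunction.ofIsRightAdjoint F).rightAdjoint_preservesLimits⟩

theorem not_isLeftAdjoint_of_not_preservesColimits {F : C ⥤ D} (h : ¬ PreservesColimits F) :
    ¬ PreservesColimits F ∧ ¬ F.IsLeftAdjoint :=
  ⟨h, fun _ => h (Adjunction.ofIsLeftAdjoint F).leftAdjoint_preservesColimits⟩

end Preservation

/-! ### Standard objects -/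

/-- The plot space on a topological space whose plots are the continuous maps. -/
def PlotSpace.ofTop (T : TestDomains) (S : Type) [TopologicalSpace S] : PlotSpace T where
  carrier := S
  str :=
    { IsPlot := fun {n} {A} φ => T.dom n A ∧ Continuous φ
      dom_of_isPlot := fun h => h.1
      isPlot_const := fun h _ => ⟨h, continuous_const⟩
      isPlot_comp := fun h hB hθ =>
        ⟨hB, h.2.comp (Continuous.subtype_mk hθ.continuous fun x => Subtype.coe_prop _)⟩
      isPlot_of_local := by
        intro n A φ hA h
        refine ⟨hA, continuous_iff_continuousAt.2 fun x => ?_⟩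
        obtain ⟨B, hB, -, hBx, -, hc⟩ := h x
        rw [ContinuousAt, ← map_nhds_inclusion hB x hBx, Filter.tendsto_map'_iff]
        exact hc.tendsto _ }

/-- The plot space for which all maps on test domains are plots. -/
def PlotSpace.indiscrete (T : TestDomains) (S : Type) : PlotSpace T where
  carrier := S
  str :=
    { IsPlot := fun {n} {A} _ => T.dom n A
      dom_of_isPlot := fun h => h
      isPlot_const := fun h _ => h
      isPlot_comp := fun _ hB _ => hB
      isPlot_of_local := fun hA _ => hA }

/-- The plot space on a subset `C` of a topological space whose plots are the (arbitrary) maps which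
locally take values in a compact subset of `C`. -/
def PlotSpace.relCompact (T : TestDomains) {Y : Type} [TopologicalSpace Y] (C : Set Y) :
    PlotSpace T where
  carrier := C
  str :=
    { IsPlot := fun {n} {A} φ => T.dom n A ∧
        ∀ x : A, ∃ K : Set Y, IsCompact K ∧ K ⊆ C ∧ ∀ᶠ y in 𝓝 x, (φ y : Y) ∈ K
      dom_of_isPlot := fun h => h.1
      isPlot_const := fun h x =>
        ⟨h, fun _ => ⟨{(x : Y)}, isCompact_singleton, by simp, by simp⟩⟩
      isPlot_comp := by
        rintro m n A B φ θ ⟨-, h⟩ hB hθ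
        refine ⟨hB, fun x => ?_⟩
        obtain ⟨K, hK, hKC, hφ⟩ := h (θ x)
        have hθc : Continuous θ := Continuous.subtype_mk hθ.continuous fun x => (θ x).2
        exact ⟨K, hK, hKC, (hθc.tendsto x).eventually hφ⟩
      isPlot_of_local := by
        intro n A φ hA h
        refine ⟨hA, fun x => ?_⟩
        obtain ⟨B, hB, -, hBx, -, hc⟩ := h x
        obtain ⟨K, hK, hKC, hφ⟩ := hc ⟨x, mem_of_mem_nhdsWithin x.2 hBx⟩
        refine ⟨K, hK, hKC, ?_⟩
        rw [← map_nhds_inclusion hB x hBx, Filter.eventually_map]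
        exact hφ }

/-- The Smith space given by a topological space and all continuous functions. -/
def SmithSpace.ofTop (S : Type) [TopologicalSpace S] : SmithSpace where
  carrier := S
  functionals := {f | Continuous f}
  continuous_of_mem _ h := h
  closure_subset _ h := h.1

/-- The morphism of Smith spaces given by a continuous map. -/
def SmithSpace.ofTopMap {S S' : Type} [TopologicalSpace S] [TopologicalSpace S'] (h : S → S')
    (hh : Continuous h) : SmithSpace.ofTop S ⟶ SmithSpace.ofTop S' :=
  SmithSpace.Hom.mk (X := SmithSpace.ofTop S) (Y := SmithSpace.ofTop S') h hh
    fun _ hf => Continuous.comp hf hh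

/-- The Sikorski space given by a topological space and the locally constant functions. -/
def SikorskiSpace.locConst (S : Type) [TopologicalSpace S] : SikorskiSpace where
  carrier := S
  functionals :=
    { carrier := {f | IsLocallyConstant f}
      mul_mem' := fun ha hb => IsLocallyConstant.mul ha hb
      add_mem' := fun ha hb => IsLocallyConstant.add ha hb
      algebraMap_mem' := fun r => IsLocallyConstant.const r }
  continuous_of_mem _ hf := IsLocallyConstant.continuous hf
  mem_of_local f h := (IsLocallyConstant.iff_eventually_eq f).2 fun x => by
    obtain ⟨V, hV, g, hg, hfg⟩ := h x
    filter_upwards [hV, IsLocallyConstant.eventually_eq hg x] with y hy hgy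
    rw [hfg y hy, hfg x (mem_of_mem_nhds hV), hgy]
  comp_mem k f hf g _ := (IsLocallyConstant.iff_eventually_eq _).2 fun x => by
    filter_upwards [Filter.eventually_all.2 fun i => IsLocallyConstant.eventually_eq (hf i) x]
      with y hy
    simp only [hy]

/-- The morphism of Sikorski spaces given by a continuous map. -/
def SikorskiSpace.locConstMap {S S' : Type} [TopologicalSpace S] [TopologicalSpace S'] (h : S → S')
    (hh : Continuous h) : SikorskiSpace.locConst S ⟶ SikorskiSpace.locConst S' :=
  SikorskiSpace.Hom.mk (X := SikorskiSpace.locConst S) (Y := SikorskiSpace.locConst S') h hh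
    fun _ hf => IsLocallyConstant.comp_continuous hf hh

/-- The Frölicher space in which all maps from `ℝ` are curves. -/
def FrolicherSpace.indiscrete (S : Type) : FrolicherSpace := FrolicherSpace.ofFunctions S ∅

/-- The Frölicher space in which all functions are functionals. -/
def FrolicherSpace.discrete (S : Type) : FrolicherSpace := FrolicherSpace.ofFunctions S Set.univ

/-- The real line with its usual smooth structure. -/
def FrolicherSpace.line : FrolicherSpace := FrolicherSpace.ofFunctions ℝ {id}

theorem FrolicherSpace.mem_curves_indiscrete {S : Type} (c : ℝ → S) :
    c ∈ (FrolicherSpace.indiscrete S).curves :=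
  fun _ hf => hf.elim

theorem FrolicherSpace.mem_functionals_discrete {S : Type} (f : S → ℝ) :
    f ∈ (FrolicherSpace.discrete S).functionals :=
  fun _ hc => hc f trivial

theorem FrolicherSpace.mem_curves_line {c : ℝ → ℝ} :
    c ∈ FrolicherSpace.line.curves ↔ ContDiff ℝ ∞ c :=
  ⟨fun h => h id rfl, by rintro h f rfl; exact h⟩

theorem FrolicherSpace.contDiff_of_mem_functionals_line {f : ℝ → ℝ}
    (hf : f ∈ FrolicherSpace.line.functionals) : ContDiff ℝ ∞ f :=
  hf id (mem_curves_line.2 contDiff_id)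

theorem FrolicherSpace.id_mem_functionals_line : id ∈ FrolicherSpace.line.functionals :=
  fun _ hc => hc id rfl

/-- The topological space `S` with a generic point `none` added, which belongs to all nonempty open
sets. -/
def WithGeneric (S : Type) : Type := Option S

namespace WithGeneric

variable {S : Type}

/-- The inclusion of a space into the space with a generic point added. -/
def incl (s : S) : WithGeneric S := (some s : Option S)

/-- The generic point. -/
def generic : WithGeneric S := (none : Option S)

theorem incl_injective : Function.Injective (incl : S → WithGeneric S) := Option.some_injective S

variable [TopologicalSpace S]

instance : TopologicalSpace (WithGeneric S) where
  IsOpen O := IsOpen (incl ⁻¹' O : Set S) ∧ (O.Nonempty → generic ∈ O)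
  isOpen_univ := ⟨isOpen_univ, fun _ => trivial⟩
  isOpen_inter O O' h h' := ⟨h.1.inter h'.1, fun ⟨x, hx, hx'⟩ => ⟨h.2 ⟨x, hx⟩, h'.2 ⟨x, hx'⟩⟩⟩
  isOpen_sUnion 𝒪 h := ⟨by
      rw [Set.preimage_sUnion]
      exact isOpen_biUnion fun O hO => (h O hO).1,
    fun ⟨x, O, hO, hx⟩ => ⟨O, hO, (h O hO).2 ⟨x, hx⟩⟩⟩

theorem isInducing_incl : IsInducing (incl : S → WithGeneric S) := by
  refine ⟨TopologicalSpace.ext_iff.2 fun V => ?_⟩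
  rw [isOpen_induced_iff]
  refine ⟨fun hV => ⟨insert generic (incl '' V), ⟨?_, fun _ => Or.inl rfl⟩, ?_⟩, ?_⟩
  · convert hV using 1
    ext s
    constructor
    · rintro (h | ⟨s', hs', h⟩)
      · exact (Option.some_ne_none s h).elim
      · rwa [← incl_injective h]
    · exact fun hs => Or.inr ⟨s, hs, rfl⟩
  · ext s
    constructor
    · rintro (h | ⟨s', hs', h⟩)
      · exact (Option.some_ne_none s h).elim
      · rwa [← incl_injective h]
    · exact fun hs => Or.inr ⟨s, hs, rfl⟩
  · rintro ⟨O, hO, rfl⟩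
    exact hO.1

theorem eq_generic_of_continuous {Y : Type} [TopologicalSpace Y] [T2Space Y] {f : WithGeneric S → Y}
    (hf : Continuous f) (x : WithGeneric S) : f x = f generic := by
  by_contra h
  obtain ⟨u, v, hu, hv, hxu, hgv, huv⟩ := t2_separation h
  exact Set.disjoint_left.1 huv ((hu.preimage hf).2 ⟨x, hxu⟩) hgv

/-- A map which takes the value `x` on a closed set and is generic elsewhere is continuous. -/
theorem continuous_ite_generic {Z : Type} [TopologicalSpace Z] {p : Z → Prop} [DecidablePred p]
    (hp : IsClosed {z | p z}) (x : WithGeneric S) :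
    Continuous (fun z => if p z then x else generic) := by
  refine ⟨fun O hO => ?_⟩
  by_cases hx : x ∈ O
  · convert isOpen_univ using 1
    refine Set.eq_univ_of_forall fun z => ?_
    simp only [Set.mem_preimage]
    split_ifs
    exacts [hx, hO.2 ⟨x, hx⟩]
  · by_cases hg : (generic : WithGeneric S) ∈ O
    · convert hp.isOpen_compl using 1
      ext z
      by_cases hz : p z <;> simp [hz, hx, hg]
    · convert isOpen_empty using 1
      ext z
      by_cases hz : p z <;> simp [hz, hx, hg]

end WithGeneric

/-! ### Elementary topology of `ℝ` and `ℚ` -/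

/-- A continuous function on the line which is constant off the origin is constant. -/
theorem eq_const_of_continuous_of_ne_zero {Y : Type} [TopologicalSpace Y] [T2Space Y] {g : ℝ → Y}
    (hg : Continuous g) {y : Y} (h : ∀ t ≠ 0, g t = y) (t : ℝ) : g t = y :=
  congrFun (Continuous.ext_on (dense_compl_singleton (0 : ℝ)) hg continuous_const
    fun t ht => h t ht) t

theorem continuous_ne_zero {K : Type} [TopologicalSpace K] [Zero K] [T1Space K] :
    Continuous (fun t : K => t ≠ 0) :=
  continuous_Prop.2 isOpen_ne

theorem not_continuous_eq_zero : ¬ Continuous (fun t : ℝ => t = 0) :=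
  fun h => not_isOpen_singleton (0 : ℝ) (continuous_Prop.1 h)

theorem rat_curve_const {c : ℝ → ℚ} (hc : Continuous fun t => (c t : ℝ)) (t : ℝ) : c t = c 0 := by
  have h1 : Continuous c := Rat.isUniformEmbedding_coe_real.isEmbedding.continuous_iff.2 hc
  exact (isPreconnected_range h1).subsingleton ⟨t, rfl⟩ ⟨0, rfl⟩

/-! ### Souriau and Frölicher spaces -/

theorem contDiff_of_forall_eq {g : ℝ → ℝ} {r : ℝ} (h : ∀ t, g t = r) : ContDiff ℝ ∞ g := by
  rw [show g = fun _ => r from funext h]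
  exact contDiff_const

/-- A subset of a plot space as a morphism to the two-point indiscrete plot space. -/
def PlotSpace.classify {T : TestDomains} (X : PlotSpace T) (p : X.carrier → Prop) :
    X ⟶ PlotSpace.indiscrete T Prop :=
  PlotSpace.Hom.mk (Y := PlotSpace.indiscrete T Prop) p fun h => X.str.dom_of_isPlot h

theorem PlotSpace.classify_condition {T : TestDomains} {A X : PlotSpace T} (ι : A ⟶ X) :
    ι ≫ X.classify (· ∈ Set.range ι.toFun) = ι ≫ X.classify fun _ => True :=
  PlotSpace.Hom.ext (funext fun a => propext ⟨fun _ => trivial, fun _ => ⟨a, rfl⟩⟩)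

/-- A subspace of a plot space is an equalizer of maps to the two-point indiscrete space. -/
noncomputable def PlotSpace.isLimitSubspace {T : TestDomains} {A X : PlotSpace T} (ι : A ⟶ X)
    (hι : Function.Injective ι.toFun)
    (hp : ∀ {n : ℕ} {U : Set (Euc n)} {φ : U → A.carrier},
      X.str.IsPlot (ι.toFun ∘ φ) → A.str.IsPlot φ) :
    IsLimit (Fork.ofι ι (PlotSpace.classify_condition ι)) := by
  refine isLimitForkOfExists _ ⟨fun a b h => PlotSpace.Hom.ext (funext fun s =>
    hι (congrFun (congrArg PlotSpace.Hom.toFun h) s))⟩ fun {S} t ht => ?_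
  have h1 : ∀ s, t.toFun s ∈ Set.range ι.toFun := fun s =>
    (congrFun (congrArg PlotSpace.Hom.toFun ht) s).mpr trivial
  choose l hl using h1
  have hlt : ι.toFun ∘ l = t.toFun := funext hl
  refine ⟨⟨l, fun {n U φ} hφ => hp ?_⟩, PlotSpace.Hom.ext hlt⟩
  rw [← Function.comp_assoc, hlt]
  exact t.isPlot hφ

/-- The map which is `x` at the origin of `ℝ` and generic elsewhere is a plot, so that functionals do
not separate `x` from the generic point. -/
theorem eq_const_of_functional_withGeneric {S : Type} [TopologicalSpace S]
    {f : WithGeneric S → ℝ}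
    (hf : f ∈ (PlotSpace.ofTop openDomains (WithGeneric S)).functionals) (x : WithGeneric S) :
    f x = f WithGeneric.generic := by
  classical
  have hφ : Continuous (fun v : (Set.univ : Set (Euc 1)) =>
      if v.1 0 = 0 then x else WithGeneric.generic) :=
    WithGeneric.continuous_ite_generic
      (isClosed_singleton.preimage (show Continuous fun v : (Set.univ : Set (Euc 1)) => v.1 0 by
        fun_prop)) x
  have h1 : SmoothMap (f ∘ fun v : (Set.univ : Set (Euc 1)) =>
      if v.1 0 = 0 then x else WithGeneric.generic) :=
    hf ⟨isOpen_univ, hφ⟩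
  have h2 : Continuous fun t : ℝ => f (if t = 0 then x else WithGeneric.generic) :=
    continuous_of_continuous_coord h1.continuous
  have h3 := eq_const_of_continuous_of_ne_zero h2 (y := f WithGeneric.generic)
    (fun t ht => by simp [ht]) 0
  simpa using h3

/-- The subspace `ℚ` of `ℚ` with a generic point has only locally constant plots, but all functionals
of the larger space are constant. -/
theorem not_preservesLimits_soFr : ¬ PreservesLimits SoFr := by
  intro hF
  let A : SouriauSpace := PlotSpace.ofTop openDomains ℚ
  let X : SouriauSpace := PlotSpace.ofTop openDomains (WithGeneric ℚ)
  let ι : A ⟶ X := PlotSpace.Hom.mk (X := A) (Y := X) (WithGeneric.incl (S := ℚ))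
    fun hφ => ⟨hφ.1, (WithGeneric.isInducing_incl (S := ℚ)).continuous.comp hφ.2⟩
  have hl := PlotSpace.isLimitSubspace ι (WithGeneric.incl_injective (S := ℚ)) fun hφ =>
    ⟨hφ.1, (WithGeneric.isInducing_incl (S := ℚ)).continuous_iff.2 hφ.2⟩
  let t : FrolicherSpace.indiscrete ℚ ⟶ SoFr.obj X :=
    FrolicherSpace.Hom.mk (X := FrolicherSpace.indiscrete ℚ) (Y := SoFr.obj X)
      (WithGeneric.incl (S := ℚ)) fun c _ f hf =>
        contDiff_of_forall_eq fun s => eq_const_of_functional_withGeneric hf _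
  obtain ⟨l, hlt⟩ := exists_lift_of_preservesLimits hF hl t
    (FrolicherSpace.Hom.ext (funext fun q => propext ⟨fun _ => trivial, fun _ => ⟨q, rfl⟩⟩))
  have hl1 : ∀ q : ℚ, l.toFun q = q := fun q =>
    WithGeneric.incl_injective (congrFun (congrArg FrolicherSpace.Hom.toFun hlt) q)
  let c : ℝ → ℚ := fun s => if s = 0 then 0 else 1
  have h1 : ContDiff ℝ ∞ ((fun q : ℚ => (q : ℝ)) ∘ l.toFun ∘ c) :=
    l.mem_curves c (FrolicherSpace.mem_curves_indiscrete c) _ fun {n U φ} hφ =>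
      smoothMap_comp_of_totallyDisconnected hφ.1 hφ.2 _
  have h2 : Continuous fun s => (c s : ℝ) :=
    h1.continuous.congr fun s => congrArg (fun q : ℚ => (q : ℝ)) (hl1 (c s))
  have h3 := rat_curve_const h2 1
  simp [c] at h3

/-- The kernel pair of a map. -/
abbrev KernelPair {S Q : Type} (q : S → Q) : Type := {p : S × S // q p.1 = q p.2}

/-- Every function on a discrete Frölicher space is a morphism. -/
def FrolicherSpace.discreteMap {S : Type} (X : FrolicherSpace) (h : S → X.carrier) :
    FrolicherSpace.discrete S ⟶ X :=
  FrolicherSpace.Hom.mk (X := FrolicherSpace.discrete S) h fun _ hc =>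
    (X.mem_curves_iff _).2 fun f _ => hc (f ∘ h) trivial

/-- The line with all nonzero points identified, as an indiscrete Frölicher space. -/
def FrolicherSpace.lineQuotient : FrolicherSpace.line ⟶ FrolicherSpace.indiscrete Prop :=
  FrolicherSpace.Hom.mk (X := FrolicherSpace.line) (Y := FrolicherSpace.indiscrete Prop)
    (fun t : ℝ => t ≠ 0) fun _ _ => FrolicherSpace.mem_curves_indiscrete _

theorem FrolicherSpace.lineQuotient_condition :
    FrolicherSpace.discreteMap FrolicherSpace.line
      (fun p : KernelPair fun t : ℝ => t ≠ 0 => p.1.1) ≫ FrolicherSpace.lineQuotient =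
    FrolicherSpace.discreteMap FrolicherSpace.line
      (fun p : KernelPair fun t : ℝ => t ≠ 0 => p.1.2) ≫ FrolicherSpace.lineQuotient :=
  FrolicherSpace.Hom.ext (funext fun p => p.2)

/-- A smooth function on the line which is constant off the origin is constant; hence the quotient
of the line which identifies all nonzero points is indiscrete. -/
noncomputable def FrolicherSpace.isColimitLineQuotient :
    IsColimit (Cofork.ofπ FrolicherSpace.lineQuotient FrolicherSpace.lineQuotient_condition) := by
  classical
  have hsurj : ∀ P : Prop, ∃ t : ℝ, (t ≠ 0) = P := fun P => by
    by_cases hP : P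
    · exact ⟨1, by simp [hP]⟩
    · exact ⟨0, by simp [hP]⟩
  refine isColimitCoforkOfExists _ ⟨fun a b h => FrolicherSpace.Hom.ext (funext fun P => ?_)⟩
    fun {S} k hk => ?_
  · obtain ⟨t, rfl⟩ := hsurj P
    exact congrFun (congrArg FrolicherSpace.Hom.toFun h) t
  · choose r hr using hsurj
    have hkr : ∀ t : ℝ, k.toFun (r (t ≠ 0)) = k.toFun t := fun t =>
      congrFun (congrArg FrolicherSpace.Hom.toFun hk)
        (⟨(r (t ≠ 0), t), hr _⟩ : KernelPair fun t : ℝ => t ≠ 0)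
    refine ⟨FrolicherSpace.Hom.mk (X := FrolicherSpace.indiscrete Prop) (fun P => k.toFun (r P))
      fun c _ => (S.mem_curves_iff _).2 fun f hf => ?_, FrolicherSpace.Hom.ext (funext hkr)⟩
    have h1 : Continuous (fun t : ℝ => f (k.toFun t)) :=
      (FrolicherSpace.contDiff_of_mem_functionals_line
        (FrolicherSpace.Hom.mem_functionals k f hf)).continuous
    have h2 : ∀ t : ℝ, f (k.toFun t) = f (k.toFun (r True)) :=
      eq_const_of_continuous_of_ne_zero h1 fun t ht => by
        rw [← hkr t, eq_true ht]
    exact contDiff_of_forall_eq fun s => h2 _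

/-- In the Souriau quotient of the line the set of nonzero points is open along plots; in the
Frölicher quotient all curves are smooth, also one for which this set is a single time. -/
theorem not_preservesColimits_frSo : ¬ PreservesColimits FrSo := by
  intro hF
  let t : FrSo.obj FrolicherSpace.line ⟶ PlotSpace.ofTop openDomains Prop :=
    PlotSpace.Hom.mk (X := FrSo.obj FrolicherSpace.line) (Y := PlotSpace.ofTop openDomains Prop)
      (fun t : ℝ => t ≠ 0) fun hφ => ⟨hφ.1, (continuous_ne_zero (K := ℝ)).comp
        (hφ.2 id FrolicherSpace.id_mem_functionals_line).continuous⟩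
  obtain ⟨l, hl⟩ := exists_desc_of_preservesColimits hF FrolicherSpace.isColimitLineQuotient t
    (PlotSpace.Hom.ext (funext fun p => p.2))
  have hl1 : ∀ s : ℝ, l.toFun (s ≠ 0) = (s ≠ 0) := fun s =>
    congrFun (congrArg PlotSpace.Hom.toFun hl) s
  let c : ℝ → Prop := fun s => s = 0
  have hc : ∀ s, l.toFun (c s) = c s := fun s => by
    by_cases hs : s = 0
    · have := hl1 1
      simp only [ne_eq, one_ne_zero, not_false_eq_true] at this
      simpa only [c, hs] using this
    · have := hl1 0
      simp only [ne_eq, not_true_eq_false] at this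
      simpa only [c, hs] using this
  obtain ⟨-, h1⟩ := l.isPlot (φ := fun v : (Set.univ : Set (Euc 1)) => c (v.1 0))
    ⟨isOpen_univ, fun f hf => ContDiff.smoothMap_coord
      (g := f ∘ c) (hf c (FrolicherSpace.mem_curves_indiscrete c))⟩
  have h2 : @Continuous ℝ Prop _ _ fun s : ℝ => l.toFun (c s) :=
    continuous_of_continuous_coord (Y := Prop) (g := fun s => l.toFun (c s)) h1
  exact not_continuous_eq_zero ((congrArg (@Continuous ℝ Prop _ _) (funext hc)).mp h2)

/-! ### Souriau and Chen spaces -/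

/-- The open upper half plane together with the origin, a convex set which is not locally compact. -/
def pointedHalfPlane : Set (Euc 2) := {v | v = 0 ∨ 0 < v 1}

/-- The origin as a point of the pointed half plane. -/
def pointedHalfPlaneOrigin : pointedHalfPlane := ⟨0, Or.inl rfl⟩

theorem convex_pointedHalfPlane : Convex ℝ pointedHalfPlane := by
  intro v hv w hw a b ha hb hab
  rcases hv with rfl | hv <;> rcases hw with rfl | hw
  · left; simp
  · rcases hb.eq_or_lt with rfl | hb
    · left; simp
    · right; simpa using mul_pos hb hw
  · rcases ha.eq_or_lt with rfl | ha
    · left; simp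
    · right; simpa using mul_pos ha hv
  · right
    change 0 < a * v 1 + b * w 1
    rcases ha.eq_or_lt with rfl | ha
    · have : b = 1 := by linarith
      simpa [this] using hw
    · have := mul_pos ha hv
      have := mul_nonneg hb hw.le
      linarith

/-- The origin has no compact neighbourhood in the pointed half plane. -/
theorem not_eventually_mem_compact {K : Set (Euc 2)} (hK : IsCompact K) (hKC : K ⊆ pointedHalfPlane)
    (h : ∀ᶠ y : pointedHalfPlane in 𝓝 pointedHalfPlaneOrigin, (y : Euc 2) ∈ K) : False := by
  rw [nhds_subtype_eq_comap_nhdsWithin, Filter.eventually_comap] at h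
  obtain ⟨r, hr, hrK⟩ := Metric.mem_nhdsWithin_iff.1 h
  -- the point `(r / 2, 0)` is a limit of points of the half plane near the origin
  have h1 : Continuous fun s : ℝ => (!₂[r / 2, s] : Euc 2) := by fun_prop
  have h2 : (!₂[r / 2, 0] : Euc 2) ∈ Metric.ball (0 : Euc 2) r := by
    rw [mem_ball_zero_iff, EuclideanSpace.norm_eq]
    simp only [Fin.sum_univ_two, Matrix.cons_val_zero, Matrix.cons_val_one, norm_zero]
    rw [zero_pow two_ne_zero, add_zero, Real.sqrt_sq (norm_nonneg _), Real.norm_eq_abs,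
      abs_of_pos (by positivity)]
    linarith
  have h3 : ∀ᶠ s in 𝓝[>] (0 : ℝ), (!₂[r / 2, s] : Euc 2) ∈ K := by
    have h4 : ∀ᶠ s in 𝓝[>] (0 : ℝ), (!₂[r / 2, s] : Euc 2) ∈ Metric.ball (0 : Euc 2) r :=
      nhdsWithin_le_nhds ((h1.tendsto 0).eventually (Metric.isOpen_ball.mem_nhds h2))
    filter_upwards [h4, self_mem_nhdsWithin] with s hs hs0
    have h5 : (!₂[r / 2, s] : Euc 2) ∈ pointedHalfPlane := Or.inr (by simpa using hs0)
    exact hrK ⟨hs, h5⟩ ⟨_, h5⟩ rfl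
  have h6 : (!₂[r / 2, 0] : Euc 2) ∈ K :=
    hK.isClosed.mem_of_tendsto ((h1.tendsto 0).mono_left nhdsWithin_le_nhds) h3
  rcases hKC h6 with h7 | h7
  · have := congrArg (fun v : Euc 2 => v 0) h7
    simp at this
    linarith
  · simp at h7

/-- A plot of the pointed half plane on an open set locally takes values in a compact subset, and so
does every map which locally factors through such plots; the identity does not. -/
theorem not_preservesLimits_soChMin : ¬ PreservesLimits SoChMin := by
  intro hF
  let A : SouriauSpace := PlotSpace.std openDomains pointedHalfPlane
  let X : SouriauSpace := PlotSpace.std openDomains (Set.univ : Set (Euc 2))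
  let i : pointedHalfPlane → (Set.univ : Set (Euc 2)) := fun v => ⟨v, trivial⟩
  have hi : Function.Injective i := fun v w h => 
    Subtype.ext (congrArg (fun z : (Set.univ : Set (Euc 2)) => z.1) h)
  let ι : A ⟶ X := PlotSpace.Hom.mk (X := A) (Y := X) i fun hφ => hφ
  have hl := PlotSpace.isLimitSubspace ι hi fun hφ => hφ
  let t : PlotSpace.std convexDomains pointedHalfPlane ⟶ SoChMin.obj X :=
    PlotSpace.Hom.mk (X := PlotSpace.std convexDomains pointedHalfPlane) (Y := SoChMin.obj X) i
      fun {n D φ} hφ => ⟨hφ.1, fun x => ⟨D, subset_rfl, hφ.1, self_mem_nhdsWithin, 2, Set.univ, id,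
        i ∘ φ, ⟨isOpen_univ, SmoothMap.val⟩, hφ.2, rfl⟩⟩
  obtain ⟨l, hlt⟩ := exists_lift_of_preservesLimits hF hl t
    (PlotSpace.Hom.ext (funext fun q => propext ⟨fun _ => trivial, fun _ => ⟨q, rfl⟩⟩))
  have hl1 : ∀ v : pointedHalfPlane, l.toFun v = v := fun v =>
    hi (congrFun (congrArg PlotSpace.Hom.toFun hlt) v)
  obtain ⟨-, h⟩ := l.isPlot (φ := (id : pointedHalfPlane → pointedHalfPlane))
    ⟨convex_pointedHalfPlane, SmoothMap.val⟩
  obtain ⟨B, hB, -, hBx, m, U, (p : U → pointedHalfPlane), θ, ⟨hU, hp⟩, hθ, hfac⟩ := h pointedHalfPlaneOrigin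
  have hpc : Continuous p := Continuous.subtype_mk hp.continuous fun x => (p x).2
  have hθc : Continuous θ := Continuous.subtype_mk hθ.continuous fun x => (θ x).2
  have : LocallyCompactSpace U := IsOpen.locallyCompactSpace hU
  let x₀ : B := ⟨0, mem_of_mem_nhdsWithin pointedHalfPlaneOrigin.2 hBx⟩
  obtain ⟨K, hK, hKx⟩ := exists_compact_mem_nhds (θ x₀)
  refine not_eventually_mem_compact (hK.image (continuous_subtype_val.comp hpc))
    (fun v ⟨u, _, hu⟩ => hu ▸ (p u).2) ?_
  rw [← map_nhds_inclusion hB _ hBx, Filter.eventually_map]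
  filter_upwards [(hθc.tendsto x₀).eventually hKx] with y hy
  refine ⟨θ y, hy, ?_⟩
  have h1 := congrFun hfac y
  exact (congrArg Subtype.val h1).symm.trans (congrArg Subtype.val (hl1 _))

theorem TestDomains.exists_dom_of_eventually (T : TestDomains) {n : ℕ} {A : Set (Euc n)}
    (hA : T.dom n A) {x : A} {p : A → Prop} (h : ∀ᶠ y in 𝓝 x, p y) :
    ∃ (B : Set (Euc n)) (hB : B ⊆ A), T.dom n B ∧ B ∈ 𝓝[A] (x : Euc n) ∧
      ∀ y : B, p (Set.inclusion hB y) := by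
  rw [nhds_subtype_eq_comap_nhdsWithin, Filter.eventually_comap] at h
  obtain ⟨B, hBA, hB, hBx, hBp⟩ := T.exists_nhds hA h
  exact ⟨B, hBA, hB, hBx, fun y => hBp y.2 _ rfl⟩

/-- The compact subsets of a set in a topological space, ordered by inclusion. -/
abbrev CompactSubsets {Y : Type} [TopologicalSpace Y] (C : Set Y) : Type :=
  {K : Set Y // IsCompact K ∧ K ⊆ C}

/-- The diagram of the compact subsets of `C`, as indiscrete plot spaces. -/
def PlotSpace.compactDiagram (T : TestDomains) {Y : Type} [TopologicalSpace Y] (C : Set Y) :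
    CompactSubsets C ⥤ PlotSpace T where
  obj K := PlotSpace.indiscrete T K.1
  map {K L} h := PlotSpace.Hom.mk (X := PlotSpace.indiscrete T K.1)
    (Y := PlotSpace.indiscrete T L.1) (Set.inclusion (leOfHom h)) fun hφ => hφ

/-- The inclusion of a compact subset. -/
def PlotSpace.relCompactIncl (T : TestDomains) {Y : Type} [TopologicalSpace Y] (C : Set Y)
    (K : CompactSubsets C) : PlotSpace.indiscrete T K.1 ⟶ PlotSpace.relCompact T C :=
  PlotSpace.Hom.mk (X := PlotSpace.indiscrete T K.1) (Y := PlotSpace.relCompact T C)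
    (Set.inclusion K.2.2) fun {_ _ φ} hφ =>
      ⟨hφ, fun _ => ⟨K.1, K.2.1, K.2.2, Filter.Eventually.of_forall fun y => (φ y).2⟩⟩

/-- The cocone of the inclusions of the compact subsets. -/
def PlotSpace.compactCocone (T : TestDomains) {Y : Type} [TopologicalSpace Y] (C : Set Y) :
    Cocone (PlotSpace.compactDiagram T C) where
  pt := PlotSpace.relCompact T C
  ι := { app := PlotSpace.relCompactIncl T C }

/-- `PlotSpace.relCompact T C` is the colimit of the compact subsets of `C`, taken as indiscrete
spaces. -/
def PlotSpace.isColimitCompactCocone (T : TestDomains) {Y : Type} [TopologicalSpace Y]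
    (C : Set Y) : IsColimit (PlotSpace.compactCocone T C) := by
  let pt : C → CompactSubsets C := fun x =>
    ⟨{(x : Y)}, isCompact_singleton, Set.singleton_subset_iff.2 x.2⟩
  let d : ∀ s : Cocone (PlotSpace.compactDiagram T C), C → s.pt.carrier := fun s x =>
    (s.ι.app (pt x)).toFun (⟨x, rfl⟩ : ({(x : Y)} : Set Y))
  have hd : ∀ (s : Cocone (PlotSpace.compactDiagram T C)) (K : CompactSubsets C) (x : K.1),
      d s (Set.inclusion K.2.2 x) = (s.ι.app K).toFun x := fun s K x =>
    (congrFun (congrArg PlotSpace.Hom.toFun (s.w (j := K) (j' := pt (Set.inclusion K.2.2 x))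
      (homOfLE (Set.singleton_subset_iff.2 x.2)))) (⟨x, rfl⟩ : ({(x : Y)} : Set Y))).symm
  exact
    { desc := fun s => PlotSpace.Hom.mk (X := PlotSpace.relCompact T C) (d s) (by
        intro n A (φ : A → C) ⟨hA, hφ⟩
        refine s.pt.str.isPlot_of_local hA fun x => ?_
        obtain ⟨K, hK, hKC, hφK⟩ := hφ x
        obtain ⟨B, hBA, hB, hBx, hBK⟩ := T.exists_dom_of_eventually hA hφK
        let ψ : B → K := fun y => ⟨φ (Set.inclusion hBA y), hBK y⟩
        have h1 := (s.ι.app ⟨K, hK, hKC⟩).isPlot (A := B) (φ := ψ) hB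
        refine ⟨B, hBA, hB, hBx, ?_⟩
        have h2 : (d s ∘ φ) ∘ Set.inclusion hBA = (s.ι.app ⟨K, hK, hKC⟩).toFun ∘ ψ :=
          funext fun y => hd s ⟨K, hK, hKC⟩ (ψ y)
        exact (congrArg (fun q => s.pt.str.IsPlot q) h2).mpr h1)
      fac := fun s K => PlotSpace.Hom.ext (funext fun x => hd s K x)
      uniq := fun s m hm => PlotSpace.Hom.ext (funext fun x : C =>
        congrFun (congrArg PlotSpace.Hom.toFun (hm (pt x))) (⟨x, rfl⟩ : ({(x : Y)} : Set Y))) }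

/-- Every smooth map from an open set to the pointed half plane locally takes values in a compact
subset, but the identity does not. -/
theorem not_preservesColimits_soChMax : ¬ PreservesColimits SoChMax := by
  intro hF
  let C := pointedHalfPlane
  have hc := isColimitOfPreserves SoChMax (PlotSpace.isColimitCompactCocone openDomains C)
  let s : Cocone (PlotSpace.compactDiagram openDomains C ⋙ SoChMax) :=
    { pt := PlotSpace.relCompact convexDomains C
      ι :=
        { app := fun K => PlotSpace.Hom.mk
            (X := SoChMax.obj (PlotSpace.indiscrete openDomains K.1))
            (Y := PlotSpace.relCompact convexDomains C) (Set.inclusion K.2.2)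
            fun hφ => (PlotSpace.relCompactIncl convexDomains C K).isPlot hφ.1
          naturality := fun _ _ _ => rfl } }
  let l := hc.desc s
  have hl : ∀ x : C, l.toFun x = x := fun x =>
    congrFun (congrArg PlotSpace.Hom.toFun (hc.fac s ⟨{(x : Euc 2)}, isCompact_singleton,
      Set.singleton_subset_iff.2 x.2⟩)) (⟨x, rfl⟩ : ({(x : Euc 2)} : Set (Euc 2)))
  obtain ⟨-, h⟩ := l.isPlot (φ := (id : C → C)) ⟨convex_pointedHalfPlane,
    PlotSpace.Hom.mk (X := PlotSpace.std openDomains C) (Y := PlotSpace.relCompact openDomains C) id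
      (by
        rintro n U θ ⟨hU, hθ⟩
        refine ⟨hU, fun x => ?_⟩
        have : LocallyCompactSpace U := IsOpen.locallyCompactSpace hU
        obtain ⟨K, hK, hKx⟩ := exists_compact_mem_nhds x
        refine ⟨_, hK.image hθ.continuous, fun v ⟨u, _, hu⟩ => hu ▸ (θ u).2, ?_⟩
        filter_upwards [hKx] with y hy using ⟨y, hy, rfl⟩), rfl⟩
  obtain ⟨K, hK, hKC, hK0⟩ := h pointedHalfPlaneOrigin
  refine not_eventually_mem_compact hK hKC (hK0.mono fun y hy => ?_)
  exact (congrArg (fun z : C => (z : Euc 2) ∈ K) (hl y)).mp hy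

/-! ### Smith spaces: an equalizer and a coequalizer -/

/-- The inclusion of `ℚ` into `ℚ` with a generic point added, as Smith spaces. -/
def ratIncl : SmithSpace.ofTop ℚ ⟶ SmithSpace.ofTop (WithGeneric ℚ) :=
  SmithSpace.ofTopMap WithGeneric.incl WithGeneric.isInducing_incl.continuous

/-- The two-point space with the indiscrete topology and the constant functions. -/
abbrev SmithSpace.indiscreteProp : SmithSpace := @SmithSpace.ofTop Prop ⊤

/-- A subset of a Smith space as a morphism to the two-point indiscrete space. -/
def SmithSpace.classify {S : Type} [TopologicalSpace S] (p : S → Prop) :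
    SmithSpace.ofTop S ⟶ SmithSpace.indiscreteProp :=
  @SmithSpace.ofTopMap S Prop _ ⊤ p continuous_top

theorem ratIncl_condition :
    ratIncl ≫ SmithSpace.classify (· ∈ Set.range WithGeneric.incl) =
      ratIncl ≫ SmithSpace.classify fun _ => True :=
  SmithSpace.Hom.ext (funext fun q => propext ⟨fun _ => trivial, fun _ => ⟨q, rfl⟩⟩)

/-- The equalizer carries all continuous functions, as there are no nonconstant smooth maps into
`ℚ` to test them. -/
noncomputable def isLimitRatIncl : IsLimit (Fork.ofι ratIncl ratIncl_condition) := by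
  refine isLimitForkOfExists _ ⟨fun a b h => SmithSpace.Hom.ext (funext fun s =>
    WithGeneric.incl_injective (S := ℚ) (congrFun (congrArg SmithSpace.Hom.toFun h) s))⟩
    fun {S} t ht => ?_
  have h1 : ∀ s, ∃ q : ℚ, WithGeneric.incl q = t.toFun s := fun s =>
    (congrFun (congrArg SmithSpace.Hom.toFun ht) s).mpr trivial
  choose l hl using h1
  have hlt : WithGeneric.incl ∘ l = t.toFun := funext hl
  have hlc : Continuous l := by
    rw [WithGeneric.isInducing_incl.continuous_iff, hlt]
    exact t.cont
  exact ⟨SmithSpace.Hom.mk (Y := SmithSpace.ofTop ℚ) l hlc fun f hf =>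
    S.mem_of_forall (Continuous.comp hf hlc) fun n U hU φ hφ =>
      smoothMap_comp_of_totallyDisconnected hU (hlc.comp hφ.1) f, SmithSpace.Hom.ext hlt⟩

/-- All maps from the line to the larger space are smooth curves, also those with two rational
values, but only constant curves are smooth in the equalizer `ℚ`. -/
theorem not_preservesLimits_smFr : ¬ PreservesLimits SmFr := by
  intro hF
  let t : FrolicherSpace.indiscrete ℚ ⟶ SmFr.obj (SmithSpace.ofTop (WithGeneric ℚ)) :=
    FrolicherSpace.Hom.mk (X := FrolicherSpace.indiscrete ℚ)
      (Y := SmFr.obj (SmithSpace.ofTop (WithGeneric ℚ))) (WithGeneric.incl (S := ℚ))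
      fun c _ f hf => contDiff_of_forall_eq fun s => WithGeneric.eq_generic_of_continuous hf _
  obtain ⟨l, hlt⟩ := exists_lift_of_preservesLimits hF isLimitRatIncl t
    (FrolicherSpace.Hom.ext (funext fun q => propext ⟨fun _ => trivial, fun _ => ⟨q, rfl⟩⟩))
  have hl1 : ∀ q : ℚ, l.toFun q = q := fun q =>
    WithGeneric.incl_injective (congrFun (congrArg FrolicherSpace.Hom.toFun hlt) q)
  let c : ℝ → ℚ := fun s => if s = 0 then 0 else 1
  have h1 : ContDiff ℝ ∞ ((fun q : ℚ => (q : ℝ)) ∘ l.toFun ∘ c) :=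
    l.mem_curves c (FrolicherSpace.mem_curves_indiscrete c) _ Rat.continuous_coe_real
  have h2 : Continuous fun s => (c s : ℝ) :=
    h1.continuous.congr fun s => congrArg (fun q : ℚ => (q : ℝ)) (hl1 (c s))
  have h3 := rat_curve_const h2 1
  simp [c] at h3

/-- The subspace `ℚ` of a Sikorski space whose functions are constant carries the locally constant
functions only. -/
theorem not_preservesLimits_smSi : ¬ PreservesLimits SmSi := by
  intro hF
  let t : SikorskiSpace.locConst ℚ ⟶ SmSi.obj (SmithSpace.ofTop (WithGeneric ℚ)) :=
    SikorskiSpace.Hom.mk (X := SikorskiSpace.locConst ℚ)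
      (Y := SmSi.obj (SmithSpace.ofTop (WithGeneric ℚ))) (WithGeneric.incl (S := ℚ))
      (WithGeneric.isInducing_incl (S := ℚ)).continuous
      fun f hf => (IsLocallyConstant.iff_exists_open _).2 fun q => ⟨Set.univ, isOpen_univ, trivial,
        fun q' _ => (WithGeneric.eq_generic_of_continuous hf _).trans
          (WithGeneric.eq_generic_of_continuous hf _).symm⟩
  obtain ⟨l, hlt⟩ := exists_lift_of_preservesLimits hF isLimitRatIncl t
    (SikorskiSpace.Hom.ext (funext fun q => propext ⟨fun _ => trivial, fun _ => ⟨q, rfl⟩⟩))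
  have hl1 : ∀ q : ℚ, l.toFun q = q := fun q =>
    WithGeneric.incl_injective (congrFun (congrArg SikorskiSpace.Hom.toFun hlt) q)
  have h1 : IsLocallyConstant ((fun q : ℚ => (q : ℝ)) ∘ l.toFun) :=
    l.mem_functionals _ Rat.continuous_coe_real
  have h2 : IsLocallyConstant fun q : ℚ => (q : ℝ) := by
    have h3 : (fun q : ℚ => (q : ℝ)) ∘ l.toFun = fun q : ℚ => (q : ℝ) :=
      funext fun q => congrArg (fun q : ℚ => (q : ℝ)) (hl1 q)
    exact (congrArg (IsLocallyConstant (X := ℚ)) h3).mp h1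
  refine not_isOpen_singleton (0 : ℚ) ?_
  convert h2 {0} using 1
  ext q
  simp

theorem SmithSpace.kernelPair_condition {S Q : Type} [TopologicalSpace S] [TopologicalSpace Q]
    {q : S → Q} (hq : IsQuotientMap q) :
    SmithSpace.ofTopMap (fun p : KernelPair q => p.1.1) (by fun_prop) ≫
        SmithSpace.ofTopMap q hq.continuous =
      SmithSpace.ofTopMap (fun p : KernelPair q => p.1.2) (by fun_prop) ≫
        SmithSpace.ofTopMap q hq.continuous :=
  SmithSpace.Hom.ext (funext fun p => p.2)

/-- A topological quotient is a coequalizer of Smith spaces with all continuous functions. -/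
noncomputable def SmithSpace.isColimitOfIsQuotientMap {S Q : Type} [TopologicalSpace S]
    [TopologicalSpace Q] {q : S → Q} (hq : IsQuotientMap q) :
    IsColimit (Cofork.ofπ (SmithSpace.ofTopMap q hq.continuous)
      (SmithSpace.kernelPair_condition hq)) := by
  refine isColimitCoforkOfExists _ ⟨fun a b h => SmithSpace.Hom.ext (funext fun x => ?_)⟩
    fun {W} k hk => ?_
  · obtain ⟨s, rfl⟩ := hq.surjective x
    exact congrFun (congrArg SmithSpace.Hom.toFun h) s
  · choose r hr using hq.surjective
    have hkr : ∀ s : S, k.toFun (r (q s)) = k.toFun s := fun s =>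
      congrFun (congrArg SmithSpace.Hom.toFun hk) (⟨(r (q s), s), hr _⟩ : KernelPair q)
    have hc : Continuous (fun x => k.toFun (r x)) := by
      refine hq.continuous_iff.2 ?_
      exact k.cont.congr fun s => (hkr s).symm
    exact ⟨SmithSpace.Hom.mk (X := SmithSpace.ofTop Q) (fun x => k.toFun (r x)) hc
      fun w hw => (W.continuous_of_mem w hw).comp hc, SmithSpace.Hom.ext (funext hkr)⟩

theorem isQuotientMap_rat_ne_zero : IsQuotientMap (fun q : ℚ => q ≠ 0) := by
  have hsurj : Function.Surjective (fun q : ℚ => q ≠ 0) := fun P => by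
    by_cases hP : P
    · exact ⟨1, by simp [hP]⟩
    · exact ⟨0, by simp [hP]⟩
  refine ⟨isCoinducing_iff.2 fun V => ⟨fun hV => ?_, fun hV => hV.preimage continuous_ne_zero⟩,
    hsurj⟩
  -- an open set of rationals which contains `0` contains a nonzero rational
  by_cases h0 : False ∈ V
  · have h1 : True ∈ V := by
      by_contra h
      refine not_isOpen_singleton (0 : ℚ) ?_
      convert hV using 1
      ext q
      by_cases hq : q = 0 <;> simp [hq, h0, h]
    convert isOpen_univ using 1
    refine Set.eq_univ_of_forall fun P => ?_
    by_cases hP : P <;> simpa [hP]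
  · by_cases h1 : True ∈ V
    · convert isOpen_singleton_true using 1
      ext P
      by_cases hP : P <;> simp [hP, h0, h1]
    · convert isOpen_empty using 1
      ext P
      by_cases hP : P <;> simp [hP, h0, h1]

/-- A continuous real function on the Sierpiński space is constant. -/
theorem eq_of_continuous_sierpinski {f : Prop → ℝ} (hf : Continuous f) (P : Prop) :
    f P = f True := by
  have h2 := eq_const_of_continuous_of_ne_zero (g := fun s : ℝ => f (s ≠ 0))
    (hf.comp continuous_ne_zero) (y := f True) (fun s hs => by simp [hs]) 0
  by_cases hP : P
  · simp [hP]
  · simpa [hP] using h2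

theorem not_continuous_of_eq_one_of_eq_zero {K : Type} [TopologicalSpace K] [Zero K]
    [(𝓝[≠] (0 : K)).NeBot] {g : K → ℝ} (h0 : g 0 = 1) (h : ∀ x ≠ 0, g x = 0) : ¬ Continuous g := by
  intro hg
  refine not_isOpen_singleton (0 : K) ?_
  convert (isOpen_ne (x := (0 : ℝ))).preimage hg using 1
  ext x
  by_cases hx : x = 0
  · simp [hx, h0]
  · simp [hx, h x hx]

/-- The space of rationals has only constant smooth curves; its Sierpiński quotient has only constant
functions, so that all curves are smooth. -/
theorem not_preservesColimits_smFr : ¬ PreservesColimits SmFr := by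
  classical
  intro hF
  let t : SmFr.obj (SmithSpace.ofTop ℚ) ⟶ FrolicherSpace.discrete Prop :=
    FrolicherSpace.Hom.mk (X := SmFr.obj (SmithSpace.ofTop ℚ)) (Y := FrolicherSpace.discrete Prop)
      (fun q : ℚ => q ≠ 0) fun c hc f _ => by
        have h1 : ContDiff ℝ ∞ ((fun q : ℚ => (q : ℝ)) ∘ c) := hc _ Rat.continuous_coe_real
        exact contDiff_of_forall_eq (r := f ((show ℚ from c 0) ≠ 0)) fun s =>
          congrArg (fun q : ℚ => f (q ≠ 0)) (rat_curve_const h1.continuous s)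
  obtain ⟨l, hl⟩ := exists_desc_of_preservesColimits hF
    (SmithSpace.isColimitOfIsQuotientMap isQuotientMap_rat_ne_zero) t
    (FrolicherSpace.Hom.ext (funext fun p => p.2))
  have hl1 : ∀ P : Prop, l.toFun P = P := fun P => by
    obtain ⟨q, rfl⟩ := isQuotientMap_rat_ne_zero.surjective P
    exact congrFun (congrArg FrolicherSpace.Hom.toFun hl) q
  -- the complementary curve in the Sierpiński space, which is not continuous
  let c : ℝ → Prop := fun s => s = 0
  let g : Prop → ℝ := fun P => if P then 1 else 0
  have h2 : ContDiff ℝ ∞ (g ∘ l.toFun ∘ c) :=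
    l.mem_curves c (fun f hf => contDiff_of_forall_eq fun s => eq_of_continuous_sierpinski hf _) g trivial
  refine not_continuous_of_eq_one_of_eq_zero (K := ℝ) (g := fun s => g (c s)) (by simp [g, c])
    (fun s hs => by simp [g, c, hs]) ?_
  exact h2.continuous.congr fun s => congrArg g (hl1 (c s))

/-! ### From Frölicher spaces to Smith spaces -/

/-- The rational numbers as a discrete Frölicher subspace of the line. -/
def FrolicherSpace.ratLine : FrolicherSpace.discrete ℚ ⟶ FrolicherSpace.line :=
  FrolicherSpace.discreteMap FrolicherSpace.line fun q : ℚ => (q : ℝ)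

/-- A subset of a Frölicher space as a morphism to the two-point indiscrete space. -/
def FrolicherSpace.classify (X : FrolicherSpace) (p : X.carrier → Prop) :
    X ⟶ FrolicherSpace.indiscrete Prop :=
  FrolicherSpace.Hom.mk (Y := FrolicherSpace.indiscrete Prop) p fun _ _ =>
    FrolicherSpace.mem_curves_indiscrete _

theorem FrolicherSpace.ratLine_condition :
    FrolicherSpace.ratLine ≫ FrolicherSpace.classify _ (· ∈ Set.range fun q : ℚ => (q : ℝ)) =
      FrolicherSpace.ratLine ≫ FrolicherSpace.classify _ fun _ => True :=
  FrolicherSpace.Hom.ext (funext fun q => propext ⟨fun _ => trivial, fun _ => ⟨q, rfl⟩⟩)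

/-- Smooth curves on the line with rational values are constant, so that the equalizer is the discrete
Frölicher space on `ℚ`. -/
noncomputable def FrolicherSpace.isLimitRatLine :
    IsLimit (Fork.ofι FrolicherSpace.ratLine FrolicherSpace.ratLine_condition) := by
  refine isLimitForkOfExists _ ⟨fun a b h => FrolicherSpace.Hom.ext (funext fun s =>
    Rat.cast_injective (α := ℝ) (congrFun (congrArg FrolicherSpace.Hom.toFun h) s))⟩
    fun {S} t ht => ?_
  have h1 : ∀ s, ∃ q : ℚ, (q : ℝ) = t.toFun s := fun s =>
    (congrFun (congrArg FrolicherSpace.Hom.toFun ht) s).mpr trivial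
  choose l hl using h1
  refine ⟨FrolicherSpace.Hom.mk (Y := FrolicherSpace.discrete ℚ) l fun c hc f _ =>
    contDiff_of_forall_eq (r := f (l (c 0))) fun s => ?_, FrolicherSpace.Hom.ext (funext hl)⟩
  have h2 : Continuous fun s => (l (c s) : ℝ) := by
    have h3 : @ContDiff ℝ _ ℝ _ _ ℝ _ _ ∞ (t.toFun ∘ c) := FrolicherSpace.mem_curves_line.1 (t.mem_curves c hc)
    exact h3.continuous.congr fun s => (hl (c s)).symm
  exact congrArg f (rat_curve_const h2 s)

/-- The image of the equalizer `ℚ` has all functions as functionals, while the functionals of a Smith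
subspace of the line are continuous for the subspace topology. -/
theorem not_preservesLimits_frSmCurv : ¬ PreservesLimits FrSmCurv := by
  intro hF
  let t : SmithSpace.ofTop ℚ ⟶ FrSmCurv.obj FrolicherSpace.line :=
    @SmithSpace.Hom.mk (SmithSpace.ofTop ℚ) (FrSmCurv.obj FrolicherSpace.line)
      (fun q : ℚ => (q : ℝ))
      (@Continuous.comp ℚ ℝ ℝ _ _ FrolicherSpace.line.curvTop _ id
        (FrolicherSpace.line.continuous_curv (FrolicherSpace.mem_curves_line.2 contDiff_id))
        Rat.continuous_coe_real)
      fun f hf => (FrolicherSpace.contDiff_of_mem_functionals_line hf).continuous.comp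
        Rat.continuous_coe_real
  obtain ⟨l, hlt⟩ := exists_lift_of_preservesLimits hF FrolicherSpace.isLimitRatLine t
    (SmithSpace.Hom.ext (funext fun q => propext ⟨fun _ => trivial, fun _ => ⟨q, rfl⟩⟩))
  have hl1 : ∀ q : ℚ, l.toFun q = q := fun q =>
    Rat.cast_injective (α := ℝ) (congrFun (congrArg SmithSpace.Hom.toFun hlt) q)
  let g : ℚ → ℝ := fun q => if q = 0 then 1 else 0
  have h1 : @Continuous ℚ ℝ _ _ (g ∘ l.toFun) :=
    l.mem_functionals g (FrolicherSpace.mem_functionals_discrete g)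
  exact not_continuous_of_eq_one_of_eq_zero (g := g) (by simp [g]) (fun q hq => by simp [g, hq])
    (h1.congr fun q => congrArg g (hl1 q))

/-- As for `FrSmCurv`; the functionals are the same for both topologies. -/
theorem not_preservesLimits_frSmFunc : ¬ PreservesLimits FrSmFunc := by
  intro hF
  let t : SmithSpace.ofTop ℚ ⟶ FrSmFunc.obj FrolicherSpace.line :=
    @SmithSpace.Hom.mk (SmithSpace.ofTop ℚ) (FrSmFunc.obj FrolicherSpace.line)
      (fun q : ℚ => (q : ℝ))
      (FrolicherSpace.line.continuous_to_funcTop (Y := ℚ) (h := fun q : ℚ => (q : ℝ)) fun f hf =>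
        (FrolicherSpace.contDiff_of_mem_functionals_line hf).continuous.comp
          Rat.continuous_coe_real)
      fun f hf => (FrolicherSpace.contDiff_of_mem_functionals_line hf).continuous.comp
        Rat.continuous_coe_real
  obtain ⟨l, hlt⟩ := exists_lift_of_preservesLimits hF FrolicherSpace.isLimitRatLine t
    (SmithSpace.Hom.ext (funext fun q => propext ⟨fun _ => trivial, fun _ => ⟨q, rfl⟩⟩))
  have hl1 : ∀ q : ℚ, l.toFun q = q := fun q =>
    Rat.cast_injective (α := ℝ) (congrFun (congrArg SmithSpace.Hom.toFun hlt) q)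
  let g : ℚ → ℝ := fun q => if q = 0 then 1 else 0
  have h1 : @Continuous ℚ ℝ _ _ (g ∘ l.toFun) :=
    l.mem_functionals g (FrolicherSpace.mem_functionals_discrete g)
  exact not_continuous_of_eq_one_of_eq_zero (g := g) (by simp [g]) (fun q hq => by simp [g, hq])
    (h1.congr fun q => congrArg g (hl1 q))

theorem eq_id_of_map_ne_zero {l : Prop → Prop} (hl : ∀ s : ℝ, l (s ≠ 0) = (s ≠ 0)) (P : Prop) :
    l P = P := by
  by_cases hP : P
  · simpa [hP] using hl 1
  · simpa [hP] using hl 0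

/-- Constant functions are functionals. -/
theorem FrolicherSpace.mem_functionals_of_forall_eq (X : FrolicherSpace) {f : X.carrier → ℝ} {r : ℝ}
    (h : ∀ x, f x = r) : f ∈ X.functionals :=
  (X.mem_functionals_iff f).2 fun c _ => contDiff_of_forall_eq fun s => h (c s)

/-- The quotient topology of the line on the set of two points is not the indiscrete topology. -/
theorem not_preservesColimits_frSmCurv : ¬ PreservesColimits FrSmCurv := by
  intro hF
  let t : FrSmCurv.obj FrolicherSpace.line ⟶ SmithSpace.ofTop Prop :=
    @SmithSpace.Hom.mk (FrSmCurv.obj FrolicherSpace.line) (SmithSpace.ofTop Prop)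
      (fun s : ℝ => s ≠ 0)
      (FrolicherSpace.line.continuous_from_curvTop (Y := Prop) (h := fun s : ℝ => s ≠ 0) fun c hc =>
        (continuous_ne_zero (K := ℝ)).comp (FrolicherSpace.mem_curves_line.1 hc).continuous)
      fun f hf => FrolicherSpace.line.mem_functionals_of_forall_eq fun s =>
        eq_of_continuous_sierpinski hf _
  obtain ⟨l, hl⟩ := exists_desc_of_preservesColimits hF FrolicherSpace.isColimitLineQuotient t
    (SmithSpace.Hom.ext (funext fun p => p.2))
  have hl1 := eq_id_of_map_ne_zero fun s => congrFun (congrArg SmithSpace.Hom.toFun hl) s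
  let c : ℝ → Prop := fun s => s = 0
  have h1 : @Continuous ℝ Prop _ _ (l.toFun ∘ c) :=
    @Continuous.comp ℝ Prop Prop _ (FrolicherSpace.indiscrete Prop).curvTop _ c l.toFun l.cont
      ((FrolicherSpace.indiscrete Prop).continuous_curv (FrolicherSpace.mem_curves_indiscrete c))
  exact not_continuous_eq_zero (h1.congr fun s => hl1 (c s))

/-- As for `FrSmCurv`; both topologies on the indiscrete quotient are indiscrete. -/
theorem not_preservesColimits_frSmFunc : ¬ PreservesColimits FrSmFunc := by
  intro hF
  let t : FrSmFunc.obj FrolicherSpace.line ⟶ SmithSpace.ofTop Prop :=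
    @SmithSpace.Hom.mk (FrSmFunc.obj FrolicherSpace.line) (SmithSpace.ofTop Prop)
      (fun s : ℝ => s ≠ 0)
      (@Continuous.comp ℝ ℝ Prop FrolicherSpace.line.funcTop _ _ id (fun s : ℝ => s ≠ 0)
        continuous_ne_zero
        (FrolicherSpace.line.continuous_func FrolicherSpace.id_mem_functionals_line))
      fun f hf => FrolicherSpace.line.mem_functionals_of_forall_eq fun s =>
        eq_of_continuous_sierpinski hf _
  obtain ⟨l, hl⟩ := exists_desc_of_preservesColimits hF FrolicherSpace.isColimitLineQuotient t
    (SmithSpace.Hom.ext (funext fun p => p.2))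
  have hl1 := eq_id_of_map_ne_zero fun s => congrFun (congrArg SmithSpace.Hom.toFun hl) s
  let c : ℝ → Prop := fun s => s = 0
  have h1 : @Continuous ℝ Prop _ _ (l.toFun ∘ c) :=
    @Continuous.comp ℝ Prop Prop _ (FrolicherSpace.indiscrete Prop).funcTop _ c l.toFun l.cont
      ((FrolicherSpace.indiscrete Prop).continuous_to_funcTop fun f hf =>
        (hf c (FrolicherSpace.mem_curves_indiscrete c)).continuous)
  exact not_continuous_eq_zero (h1.congr fun s => hl1 (c s))

/-! ### From Sikorski spaces to Smith spaces -/

theorem SikorskiSpace.kernelPair_condition {S Q : Type} [TopologicalSpace S] [TopologicalSpace Q]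
    {q : S → Q} (hq : IsQuotientMap q) :
    SikorskiSpace.locConstMap (fun p : KernelPair q => p.1.1) (by fun_prop) ≫
        SikorskiSpace.locConstMap q hq.continuous =
      SikorskiSpace.locConstMap (fun p : KernelPair q => p.1.2) (by fun_prop) ≫
        SikorskiSpace.locConstMap q hq.continuous :=
  SikorskiSpace.Hom.ext (funext fun p => p.2)

/-- A topological quotient is a coequalizer of Sikorski spaces with the locally constant
functions. -/
noncomputable def SikorskiSpace.isColimitOfIsQuotientMap {S Q : Type} [TopologicalSpace S]
    [TopologicalSpace Q] {q : S → Q} (hq : IsQuotientMap q) :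
    IsColimit (Cofork.ofπ (SikorskiSpace.locConstMap q hq.continuous)
      (SikorskiSpace.kernelPair_condition hq)) := by
  refine isColimitCoforkOfExists _ ⟨fun a b h => SikorskiSpace.Hom.ext (funext fun x => ?_)⟩
    fun {W} k hk => ?_
  · obtain ⟨s, rfl⟩ := hq.surjective x
    exact congrFun (congrArg SikorskiSpace.Hom.toFun h) s
  · choose r hr using hq.surjective
    have hkr : ∀ s : S, k.toFun (r (q s)) = k.toFun s := fun s =>
      congrFun (congrArg SikorskiSpace.Hom.toFun hk) (⟨(r (q s), s), hr _⟩ : KernelPair q)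
    have hc : Continuous (fun x => k.toFun (r x)) := by
      refine hq.continuous_iff.2 ?_
      exact k.cont.congr fun s => (hkr s).symm
    refine ⟨SikorskiSpace.Hom.mk (X := SikorskiSpace.locConst Q) (fun x => k.toFun (r x)) hc
      fun w hw V => ?_, SikorskiSpace.Hom.ext (funext hkr)⟩
    refine hq.isOpen_preimage.1 ?_
    have h1 : IsLocallyConstant (X := S) (w ∘ k.toFun) := k.mem_functionals w hw
    convert h1 V using 1
    ext s
    exact iff_of_eq (congrArg (fun z => w z ∈ V) (hkr s))

/-- The unit interval is a quotient of the Cantor space. On the latter, the closure of the locally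
constant functions consists of all continuous functions, but on the interval it does not. -/
theorem not_preservesColimits_siSm : ¬ PreservesColimits SiSm := by
  intro hF
  obtain ⟨q, hqc, hqs⟩ := exists_nat_bool_continuous_surjective_of_compact unitInterval
  have hq : IsQuotientMap q := hqc.isClosedMap.isQuotientMap hqc hqs
  let t : SiSm.obj (SikorskiSpace.locConst (ℕ → Bool)) ⟶ SmithSpace.ofTop unitInterval :=
    SmithSpace.Hom.mk (X := SiSm.obj (SikorskiSpace.locConst (ℕ → Bool)))
      (Y := SmithSpace.ofTop unitInterval) q hqc fun f hf => ⟨Continuous.comp hf hqc,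
        fun n U hU φ hφ => by
          have h1 : @Continuous U (ℕ → Bool) _ _ φ := hφ.1
          exact smoothMap_comp_of_totallyDisconnected hU h1 (f ∘ q)⟩
  obtain ⟨l, hl⟩ := exists_desc_of_preservesColimits hF
    (SikorskiSpace.isColimitOfIsQuotientMap hq) t (SmithSpace.Hom.ext (funext fun p => p.2))
  have hl1 : ∀ x : unitInterval, l.toFun x = x := fun x => by
    obtain ⟨s, rfl⟩ := hq.surjective x
    exact congrFun (congrArg SmithSpace.Hom.toFun hl) s
  let p : ℝ → unitInterval := fun s => Set.projIcc 0 1 zero_le_one |s|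
  obtain ⟨-, h1⟩ := l.mem_functionals (fun x : unitInterval => (x : ℝ)) continuous_subtype_val
  have hp : Continuous fun v : (Set.univ : Set (Euc 1)) => p (v.1 0) :=
    continuous_projIcc.comp (by fun_prop)
  have h2 := h1 1 Set.univ isOpen_univ (fun v => p (v.1 0)) ⟨hp, fun f hf => by
    have h3 : IsLocallyConstant (X := unitInterval) f := hf
    have h4 : (f ∘ fun v : (Set.univ : Set (Euc 1)) => p (v.1 0)) = fun _ => f (p 0) :=
      funext fun v => h3.apply_eq_of_preconnectedSpace _ _
    exact (congrArg SmoothMap h4).mpr (SmoothMap.const _)⟩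
  have h3 : ContDiff ℝ ∞ (fun s : ℝ => (p s : ℝ)) := by
    have h4 := h2.contDiff_comp (W := ℝ) (c := fun s => ⟨WithLp.toLp 2 fun _ => s, trivial⟩)
      (by fun_prop)
    have h5 : (fun s : ℝ => (p s : ℝ)) = _ := funext fun s =>
      (congrArg (fun x : unitInterval => (x : ℝ)) (hl1 (p s))).symm
    rw [h5]
    exact h4
  refine not_differentiableAt_abs_zero ((h3.differentiable (by simp) 0).congr_of_eventuallyEq ?_)
  filter_upwards [Metric.closedBall_mem_nhds (0 : ℝ) one_pos] with s hs
  rw [mem_closedBall_zero_iff, Real.norm_eq_abs] at hs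
  simp only [p]
  rw [Set.projIcc_of_mem zero_le_one ⟨abs_nonneg s, hs⟩]

/-! ### Adjoints and preservation of limits and colimits -/

/-- The adjunctions among the functors between Chen, Souriau, Frölicher, Smith and Sikorski spaces:
the four that exist, and the non-existence of any further left or right adjoint, in each case because
some small limit or colimit is not preserved. -/
theorem mainTheorem9 :
    -- the adjunctions which exist
    (Nonempty (SoFr ⊣ FrSo) ∧ Nonempty (SoChMin ⊣ ChSo) ∧ Nonempty (ChSo ⊣ SoChMax) ∧
      Nonempty (SmSi ⊣ SiSm)) ∧
    -- Frölicher and Smith: no adjunction at all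
    ((¬ PreservesLimits SmFr ∧ ¬ SmFr.IsRightAdjoint) ∧
      (¬ PreservesColimits SmFr ∧ ¬ SmFr.IsLeftAdjoint) ∧
      (¬ PreservesLimits FrSmCurv ∧ ¬ FrSmCurv.IsRightAdjoint) ∧
      (¬ PreservesColimits FrSmCurv ∧ ¬ FrSmCurv.IsLeftAdjoint) ∧
      (¬ PreservesLimits FrSmFunc ∧ ¬ FrSmFunc.IsRightAdjoint) ∧
      (¬ PreservesColimits FrSmFunc ∧ ¬ FrSmFunc.IsLeftAdjoint)) ∧
    -- Smith and Sikorski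
    ((¬ PreservesColimits SiSm ∧ ¬ SiSm.IsLeftAdjoint) ∧
      (¬ PreservesLimits SmSi ∧ ¬ SmSi.IsRightAdjoint)) ∧
    -- Frölicher and Souriau
    ((¬ PreservesLimits SoFr ∧ ¬ SoFr.IsRightAdjoint) ∧
      (¬ PreservesColimits FrSo ∧ ¬ FrSo.IsLeftAdjoint)) ∧
    -- Souriau and Chen: the two adjoints of `ChSo` have no further adjoints
    ((¬ PreservesColimits SoChMax ∧ ¬ SoChMax.IsLeftAdjoint) ∧
      (¬ PreservesLimits SoChMin ∧ ¬ SoChMin.IsRightAdjoint)) := by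
  refine ⟨⟨⟨soFrAdjFrSo⟩, ⟨soChMinAdjChSo⟩, ⟨chSoAdjSoChMax⟩, ⟨smSiAdjSiSm⟩⟩, ⟨?_, ?_, ?_, ?_, ?_, ?_⟩,
    ⟨?_, ?_⟩, ⟨?_, ?_⟩, ⟨?_, ?_⟩⟩
  · exact not_isRightAdjoint_of_not_preservesLimits not_preservesLimits_smFr
  · exact not_isLeftAdjoint_of_not_preservesColimits not_preservesColimits_smFr
  · exact not_isRightAdjoint_of_not_preservesLimits not_preservesLimits_frSmCurv
  · exact not_isLeftAdjoint_of_not_preservesColimits not_preservesColimits_frSmCurv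
  · exact not_isRightAdjoint_of_not_preservesLimits not_preservesLimits_frSmFunc
  · exact not_isLeftAdjoint_of_not_preservesColimits not_preservesColimits_frSmFunc
  · exact not_isLeftAdjoint_of_not_preservesColimits not_preservesColimits_siSm
  · exact not_isRightAdjoint_of_not_preservesLimits not_preservesLimits_smSi
  · exact not_isRightAdjoint_of_not_preservesLimits not_preservesLimits_soFr
  · exact not_isLeftAdjoint_of_not_preservesColimits not_preservesColimits_frSo
  · exact not_isLeftAdjoint_of_not_preservesColimits not_preservesColimits_soChMax
  · exact not_isRightAdjoint_of_not_preservesLimits not_preservesLimits_soChMin
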